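/- **Lemma (Quadratic Reduction Phase).** Write $[k]=\{0,\dots,k-1\}$ and $\log=\log_2$. There is an absolute constant $C>0$ such that the following holds for all integers $\Delta\ge 1$ and $2\le N\le 4(\Delta+1)^2$. *Parameters.* Put $m_1=\lceil 4\Delta^{3/2}\log^2N\rceil$ and $m_2=\lceil 4\sqrt\Delta\log^2N\rceil$. Choose a prime $\lambda\in(\sqrt{m_1}+1,\,2(\sqrt{m_1}+1)]$, put $m_3=\lceil16\sqrt\Delta\log^2(\lambda^2m_2)\rceil$, and choose primes $\mu\in(\sqrt\Delta+\sqrt{m_3},\,2(\sqrt\Delta+\sqrt{m_3})]$ and $\tau\in(2\Delta^{1/4}\log(\lambda^2m_2),\,4\Delta^{1/4}\log(\lambda^2m_2)]$. Let $\ell_2=2\lambda^3(\mu+1)m_3$, $\ell_3=\lceil\Delta+(2\sqrt{m_3}+1)\mu\rceil$, $I_3=[0,\ell_3)$, $I_2=[\ell_3,\ell_3+\ell_2)$ and $I_1^*=[\ell_3+\ell_2,\ell_3+\ell_2+N)$. A color in $I_2$ is written uniquely as $\ell_3+\langle a,b,c,d\rangle=\ell_3+a\cdot2\lambda(\mu+1)m_3+b\cdot2\lambda(\mu+1)+c(\mu+1)+d$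 with $a\in[\lambda^2]$, $b\in[m_3]$, $c\in[2\lambda]$, $d\in[\mu+1]$. Choose - a family $(S_a^{(i)})_{i\in I_1^*}$ of $N$ distinct subsets of $[m_1]$ such that for every member $S_0$ and all (not necessarily different) members $S_1,\dots,S_\Delta\ne S_0$ some $x\in S_0$ lies in at most $\Delta^{1/4}$ of $S_1,\dots,S_\Delta$; - a family $(S_b^{(i)})_{i\in I_1^*}$ of $N$ distinct subsets of $[m_2]$ such that no member is contained in the union of $\lfloor\Delta^{1/4}\rfloor$ other members; - distinct polynomials $P_i$, $i\in[\lambda^2m_2]$, over $GF(\tau)$ of degree at most $\lfloor\log(\lambda^2m_2)\rfloor$; put $S_c^{(i)}=\{x\tau+P_i(x):x\in[\tau]\}$. *One round.* Let $G$ be a finite graph with all degrees at most $\Delta$. In round $t$ every vertex $v$ computes $\phi_t(v)$ from $\phi_{t-1}$ as follows; $a,b,c,d$ denote the coordinates of colors in $I_2$ at the end of round $t-1$, $\hat a=\lfloor a/\lambda\rfloor$, $\tilde a=a\bmod\lambda$, and $N_2(v)$ is the set of neighbors $u$ of $v$ with $\phi_{t-1}(u)\in I_2$. - *Transition-in*,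 if $\phi_{t-1}(v)\in I_1^*$. For $x\in S_a^{(\phi_{t-1}(v))}$ let $N'(v,x)$ be the set of neighbors $u$ with $\phi_{t-1}(u)\in I_1^*$ and $x\in S_a^{(\phi_{t-1}(u))}$. The new $a$ is the least $x\in S_a^{(\phi_{t-1}(v))}$ with $|N'(v,x)|\le\Delta^{1/4}$, the new $b$ is $\min\big(S_b^{(\phi_{t-1}(v))}\setminus\bigcup_{u\in N'(v,a)}S_b^{(\phi_{t-1}(u))}\big)$, and $c=0$, $d=\mu$. - *Core*, if $\phi_{t-1}(v)\in I_2$ and $a(v)\ge\lambda$. Let $M$ be the set of $u\in N_2(v)$ with $\hat a(u)\ne\hat a(v)$ and $\tilde a(u)=\tilde a(v)$. If $|M|>\Delta^{1/4}$, then $a(v)$ becomes $\hat a(v)\lambda+((\hat a(v)+\tilde a(v))\bmod\lambda)$ and $b,c,d$ are kept. Otherwise let $M'$, resp. $\overline M'$, be the set of $u\in N_2(v)$ with $\tilde a(u)=\tilde a(v)$ and $\hat a(u)=0$, resp. $\hat a(u)\ne0$; then $a(v)$ becomes $\tilde a(v)$, $b(v)$ becomes $\min\big(S_c^{(a(v)m_2+b(v))}\setminus(\{b(u):u\in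 M'\}\cup\bigcup_{u\in\overline M'}S_c^{(a(u)m_2+b(u))})\big)$, $c(v)$ becomes $1+\max_{u\in M'}c(u)$ (with $\max\emptyset=0$), and $d$ is kept. - *Transition-out*, if $\phi_{t-1}(v)\in I_2$ and $a(v)<\lambda$. If some $u\in N_2(v)$ violates $a(v)\le a(u)<\lambda$, the color is kept. Otherwise let $A(v)=\{u\in N_2(v):a(u)=a(v),\,c(u)\le c(v)\}$, let $L_i(v)=\{((\lfloor b(v)/\tau\rfloor x^2+(b(v)\bmod\tau)x+i)\bmod\mu)+x\mu:x\in[\mu]\}$, and let $L(v)$ be the set of colors in $I_3$ held by neighbors of $v$. If $d(v)=\mu$, then $d(v)$ becomes some $i\in[\mu]$ minimizing $|L_i(v)\cap L(v)|$. If $d(v)\ne\mu$ and $d(u)\ne\mu$ for all $u\in A(v)$, then the new color is the element of $L_{d(v)}(v)\setminus(L(v)\cup\bigcup_{u\in A(v)}L_{d(u)}(u))$ with the least $x$. Otherwise the color is kept. - *Standard reduction*, if $\phi_{t-1}(v)\in I_3$. If all neighbors of $v$ have colors in $I_3$ that are smaller than $\phi_{t-1}(v)$, the new color is the least element of $[\Delta+1]$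 not held by a neighbor; otherwise the color is kept. *Claim.* The primes, families and polynomials above exist. For every choice of them, if $\Delta\ge2$ then $$\lambda\le C\,\Delta^{3/4}\log\Delta,\qquad |I_3|=\ell_3\le\Delta+C\,\Delta^{3/4}\log\Delta .$$ Moreover, let $r^*\ge 0$ and let $\phi_{r^*}$ be any proper coloring of $G$ with colors in $I_1^*$ (such as the $O(\Delta^2)$-coloring left by the Linial phase at round $r^*$, with $N=n_{r^*}\le4(\Delta+1)^2$ colors). Then the rounds $r^*+1,r^*+2,\dots$ can always be carried out (every set whose least element is taken is nonempty), and for every resulting sequence $\phi_{r^*},\phi_{r^*+1},\dots$: 1. $\phi_{r^*+2+3\lambda}(v)\in I_3$ for every vertex $v$; 2. $\phi_t$ is proper for every $t\in[r^*+1,\,r^*+2+3\lambda]$; 3. after round $r^*+1$ all colors lie in $I_2$, and the $a$ values form a $\Delta^{1/4}$-defective coloring with colors in $[\lambda^2]$: every $v$ has at most $\Delta^{1/4}$ neighbors with the same $a$ value; 4. for every $v$ there is a round $t\in[r^*+1,\,r^*+2+\lambda]$ after which $v$ has a color in $I_2$ with $a(v)\in[\lambda]$, and from then on $a(v)\in[\lambda]$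 as long as the color of $v$ lies in $I_2$; 5. after every round $t\ge r^*+1$ the $a$ values on the vertices with colors in $I_2$ are $(2\Delta^{1/4})$-arbdefective, oriented by the $c$ values: every such $v$ has at most $2\Delta^{1/4}$ neighbors $u$ with color in $I_2$, $a(u)=a(v)$ and $c(u)\le c(v)$. -/

import Mathlib

namespace LocIter

/-- `F 0, …, F (N-1)` is a family of `N` distinct subsets of `[m] = {0, …, m-1}`. -/
def IsSetSystem (N m : ℕ) (F : ℕ → Finset ℕ) : Prop :=
  (∀ i < N, F i ⊆ Finset.range m) ∧ Set.InjOn F (Set.Iio N)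

/-- The family `F 0, …, F (N-1)` is `d`-cover-free: no member is contained in the union of `d`
(not necessarily different) other members. -/
def CoverFree (d N : ℕ) (F : ℕ → Finset ℕ) : Prop :=
  ∀ i < N, ∀ f : Fin d → ℕ, (∀ j, f j < N ∧ f j ≠ i) → ∃ x ∈ F i, ∀ j, x ∉ F (f j)

/-- The family `F 0, …, F (N-1)` is `d`-union-`(ρ+1)`-cover-free: whenever `S₁, …, S_d` are `d`
(not necessarily different) members other than the member `S₀`, some `x ∈ S₀` satisfies
`|{j | x ∈ S_j}| ≤ ρ`. -/
def UnionCoverFree (d ρ N : ℕ) (F : ℕ → Finset ℕ) : Prop :=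
  ∀ i < N, ∀ f : Fin d → ℕ, (∀ j, f j < N ∧ f j ≠ i) →
    ∃ x ∈ F i, (Finset.univ.filter (fun j => x ∈ F (f j))).card ≤ ρ

/-- `⌊Δ^{1/4}⌋`; for an integer `k`, `k ≤ Δ^{1/4}` is the same as `k ≤ ⌊Δ^{1/4}⌋`. -/
noncomputable def rho (Δ : ℕ) : ℕ := ⌊(Δ : ℝ) ^ (1 / 4 : ℝ)⌋₊

/-- `m₁ = ⌈4 Δ^{3/2} log² N⌉`. -/
noncomputable def m1 (Δ N : ℕ) : ℕ := ⌈4 * (Δ : ℝ) ^ (3 / 2 : ℝ) * Real.logb 2 N ^ 2⌉₊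

/-- `m₂ = ⌈4 √Δ log² N⌉`. -/
noncomputable def m2 (Δ N : ℕ) : ℕ := ⌈4 * √(Δ : ℝ) * Real.logb 2 N ^ 2⌉₊

/-- `m₃ = ⌈16 √Δ log² (λ² m₂)⌉`. -/
noncomputable def m3 (Δ N lam : ℕ) : ℕ :=
  ⌈16 * √(Δ : ℝ) * Real.logb 2 ((lam : ℝ) ^ 2 * m2 Δ N) ^ 2⌉₊

/-- The free choices made when the algorithm is set up for maximum degree `Δ` and a starting
palette of `N` colors: the primes `λ, μ, τ`, the set families `F_a` and `F_b`, and the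
polynomials over `GF(τ)` that define the family `F_c`. -/
structure Params (Δ N : ℕ) where
  lam : ℕ
  mu : ℕ
  tau : ℕ
  lam_prime : lam.Prime
  mu_prime : mu.Prime
  tau_prime : tau.Prime
  lam_gt : √(m1 Δ N : ℝ) + 1 < lam
  lam_le : (lam : ℝ) ≤ 2 * (√(m1 Δ N : ℝ) + 1)
  mu_gt : √(Δ : ℝ) + √(m3 Δ N lam : ℝ) < mu
  mu_le : (mu : ℝ) ≤ 2 * (√(Δ : ℝ) + √(m3 Δ N lam : ℝ))
  tau_gt : 2 * (Δ : ℝ) ^ (1 / 4 : ℝ) * Real.logb 2 ((lam : ℝ) ^ 2 * m2 Δ N) < tau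
  tau_le : (tau : ℝ) ≤ 2 * (2 * (Δ : ℝ) ^ (1 / 4 : ℝ) * Real.logb 2 ((lam : ℝ) ^ 2 * m2 Δ N))
  /-- `F_a`, indexed by the colors of the starting palette. -/
  Fa : ℕ → Finset ℕ
  Fa_system : IsSetSystem N (m1 Δ N) Fa
  Fa_coverFree : UnionCoverFree Δ (rho Δ) N Fa
  /-- `F_b`, indexed by the colors of the starting palette. -/
  Fb : ℕ → Finset ℕ
  Fb_system : IsSetSystem N (m2 Δ N) Fb
  Fb_coverFree : CoverFree (rho Δ) N Fb
  /-- The polynomial over `GF(τ)` associated with `i ∈ [λ² m₂]`. -/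
  poly : ℕ → Polynomial (ZMod tau)
  poly_degree : ∀ i < lam ^ 2 * m2 Δ N, (poly i).natDegree ≤ Nat.log 2 (lam ^ 2 * m2 Δ N)
  poly_inj : Set.InjOn poly (Set.Iio (lam ^ 2 * m2 Δ N))

namespace Params

/-- `ℓ₂ = 2 λ³ (μ+1) m₃`. -/
noncomputable def ell2 {Δ N : ℕ} (P : Params Δ N) : ℕ :=
  2 * P.lam ^ 3 * (P.mu + 1) * m3 Δ N P.lam

/-- `ℓ₃ = Δ + (2 √m₃ + 1) μ`, rounded up. -/
noncomputable def ell3 {Δ N : ℕ} (P : Params Δ N) : ℕ :=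
  ⌈(Δ : ℝ) + (2 * √(m3 Δ N P.lam : ℝ) + 1) * P.mu⌉₊

/-- `[ℓ₃ + ℓ₂, ℓ₃ + ℓ₂ + N)`, the part of `I₁` that holds the starting coloring. -/
noncomputable def I1 {Δ N : ℕ} (P : Params Δ N) : Finset ℕ :=
  Finset.Ico (P.ell3 + P.ell2) (P.ell3 + P.ell2 + N)

/-- `I₂ = [ℓ₃, ℓ₃ + ℓ₂)`. -/
noncomputable def I2 {Δ N : ℕ} (P : Params Δ N) : Finset ℕ :=
  Finset.Ico P.ell3 (P.ell3 + P.ell2)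

/-- `I₃ = [0, ℓ₃)`. -/
noncomputable def I3 {Δ N : ℕ} (P : Params Δ N) : Finset ℕ := Finset.range P.ell3

/-- The position in the starting palette of a color `k ∈ I₁`. -/
noncomputable def idx {Δ N : ℕ} (P : Params Δ N) (k : ℕ) : ℕ := k - (P.ell3 + P.ell2)

/-- The color `ℓ₃ + ⟨a, b, c, d⟩`. -/
noncomputable def encode {Δ N : ℕ} (P : Params Δ N) (a b c d : ℕ) : ℕ :=
  P.ell3 + (a * (2 * P.lam * (P.mu + 1) * m3 Δ N P.lam) + b * (2 * P.lam * (P.mu + 1))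
    + c * (P.mu + 1) + d)

/-- The coordinates `a, b, c, d` of a color `k = ℓ₃ + ⟨a, b, c, d⟩ ∈ I₂`. -/
noncomputable def a {Δ N : ℕ} (P : Params Δ N) (k : ℕ) : ℕ :=
  (k - P.ell3) / (2 * P.lam * (P.mu + 1) * m3 Δ N P.lam)

noncomputable def b {Δ N : ℕ} (P : Params Δ N) (k : ℕ) : ℕ :=
  (k - P.ell3) % (2 * P.lam * (P.mu + 1) * m3 Δ N P.lam) / (2 * P.lam * (P.mu + 1))

noncomputable def c {Δ N : ℕ} (P : Params Δ N) (k : ℕ) : ℕ :=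
  (k - P.ell3) % (2 * P.lam * (P.mu + 1)) / (P.mu + 1)

noncomputable def d {Δ N : ℕ} (P : Params Δ N) (k : ℕ) : ℕ := (k - P.ell3) % (P.mu + 1)

/-- `â = ⌊a / λ⌋` and `ã = a mod λ`. -/
noncomputable def aHat {Δ N : ℕ} (P : Params Δ N) (k : ℕ) : ℕ := P.a k / P.lam

noncomputable def aTilde {Δ N : ℕ} (P : Params Δ N) (k : ℕ) : ℕ := P.a k % P.lam

/-- `S_c^{(i)} = {x τ + P_i(x) | x ∈ [τ]}`. -/
noncomputable def Sc {Δ N : ℕ} (P : Params Δ N) (i : ℕ) : Finset ℕ :=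
  (Finset.range P.tau).image (fun x : ℕ => x * P.tau + ZMod.val ((P.poly i).eval (x : ZMod P.tau)))

/-- The index `a m₂ + b` into `F_c` that belongs to a color of `I₂`. -/
noncomputable def scIdx {Δ N : ℕ} (P : Params Δ N) (k : ℕ) : ℕ := P.a k * m2 Δ N + P.b k

/-- `(⌊b/τ⌋ x² + (b mod τ) x + i) mod μ`, with `b` the second coordinate of the color `k ∈ I₂`. -/
noncomputable def quad {Δ N : ℕ} (P : Params Δ N) (k i x : ℕ) : ℕ :=
  (P.b k / P.tau * x ^ 2 + P.b k % P.tau * x + i) % P.mu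

/-- `L_i = {quad_i(x) + x μ | x ∈ [μ]}`, for a vertex whose color is `k ∈ I₂`. -/
noncomputable def L {Δ N : ℕ} (P : Params Δ N) (k i : ℕ) : Finset ℕ :=
  (Finset.range P.mu).image (fun x => P.quad k i x + x * P.mu)

section Algorithm

/-! Below `φ` is the coloring at the beginning of a round, and `k'` is the color of the vertex `v`
at the end of that round. -/

/-- The neighbors of `v` with a color in `I₂`. -/
noncomputable def nbrs2 {Δ N : ℕ} (P : Params Δ N) {V : Type*} [Fintype V] (G : SimpleGraph V)
    [DecidableRel G.Adj] (φ : V → ℕ) (v : V) : Finset V :=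
  (G.neighborFinset v).filter (fun u => φ u ∈ P.I2)

/-- `N'(v, x)`: the neighbors `u` of `v` with a color in the starting palette and with
`x ∈ S_a^{(φ u)}`. -/
noncomputable def nbrsIn {Δ N : ℕ} (P : Params Δ N) {V : Type*} [Fintype V] (G : SimpleGraph V)
    [DecidableRel G.Adj] (φ : V → ℕ) (v : V) (x : ℕ) : Finset V :=
  (G.neighborFinset v).filter (fun u => φ u ∈ P.I1 ∧ x ∈ P.Fa (P.idx (φ u)))

/-- The transition-in stage. -/
def TransitionIn {Δ N : ℕ} (P : Params Δ N) {V : Type*} [Fintype V] (G : SimpleGraph V)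
    [DecidableRel G.Adj] (φ : V → ℕ) (v : V) (k' : ℕ) : Prop :=
  ∃ a' b' : ℕ,
    IsLeast {x | x ∈ P.Fa (P.idx (φ v)) ∧ (P.nbrsIn G φ v x).card ≤ rho Δ} a' ∧
    IsLeast {y | y ∈ P.Fb (P.idx (φ v)) ∧
      ∀ u ∈ P.nbrsIn G φ v a', y ∉ P.Fb (P.idx (φ u))} b' ∧
    k' = P.encode a' b' 0 P.mu

/-- `M(v)`: the neighbors in `I₂` with a different `â` and the same `ã`. -/
noncomputable def M {Δ N : ℕ} (P : Params Δ N) {V : Type*} [Fintype V] (G : SimpleGraph V)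
    [DecidableRel G.Adj] (φ : V → ℕ) (v : V) : Finset V :=
  (P.nbrs2 G φ v).filter (fun u => P.aHat (φ u) ≠ P.aHat (φ v) ∧ P.aTilde (φ u) = P.aTilde (φ v))

/-- `M'(v)`: the neighbors in `I₂` with `â = 0` and the same `ã`. -/
noncomputable def M' {Δ N : ℕ} (P : Params Δ N) {V : Type*} [Fintype V] (G : SimpleGraph V)
    [DecidableRel G.Adj] (φ : V → ℕ) (v : V) : Finset V :=
  (P.nbrs2 G φ v).filter (fun u => P.aHat (φ u) = 0 ∧ P.aTilde (φ u) = P.aTilde (φ v))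

/-- The neighbors in `I₂` with `â ≠ 0` and the same `ã`. -/
noncomputable def Mbar' {Δ N : ℕ} (P : Params Δ N) {V : Type*} [Fintype V] (G : SimpleGraph V)
    [DecidableRel G.Adj] (φ : V → ℕ) (v : V) : Finset V :=
  (P.nbrs2 G φ v).filter (fun u => P.aHat (φ u) ≠ 0 ∧ P.aTilde (φ u) = P.aTilde (φ v))

/-- The core stage. The maximum over an empty set of (nonnegative) `c` values is `0`. -/
def Core {Δ N : ℕ} (P : Params Δ N) {V : Type*} [Fintype V] (G : SimpleGraph V)
    [DecidableRel G.Adj] (φ : V → ℕ) (v : V) (k' : ℕ) : Prop :=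
  ((P.M G φ v).card ≤ rho Δ →
    ∃ b' : ℕ,
      IsLeast {y | y ∈ P.Sc (P.scIdx (φ v)) ∧ (∀ u ∈ P.M' G φ v, y ≠ P.b (φ u)) ∧
        ∀ u ∈ P.Mbar' G φ v, y ∉ P.Sc (P.scIdx (φ u))} b' ∧
      k' = P.encode (P.aTilde (φ v)) b' (1 + (P.M' G φ v).sup (fun u => P.c (φ u))) (P.d (φ v))) ∧
  (rho Δ < (P.M G φ v).card →
    k' = P.encode (P.aHat (φ v) * P.lam + (P.aHat (φ v) + P.aTilde (φ v)) % P.lam)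
      (P.b (φ v)) (P.c (φ v)) (P.d (φ v)))

/-- `A(v)`: the neighbors in `I₂` with the same `a` and with `c(u) ≤ c(v)`. -/
noncomputable def A {Δ N : ℕ} (P : Params Δ N) {V : Type*} [Fintype V] (G : SimpleGraph V)
    [DecidableRel G.Adj] (φ : V → ℕ) (v : V) : Finset V :=
  (P.nbrs2 G φ v).filter (fun u => P.a (φ u) = P.a (φ v) ∧ P.c (φ u) ≤ P.c (φ v))

/-- `L(v)`: the colors of `I₃` that are held by neighbors of `v`. -/
noncomputable def occupied {Δ N : ℕ} (P : Params Δ N) {V : Type*} [Fintype V] (G : SimpleGraph V)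
    [DecidableRel G.Adj] (φ : V → ℕ) (v : V) : Finset ℕ :=
  ((G.neighborFinset v).filter (fun u => φ u ∈ P.I3)).image φ

/-- Every neighbor `u` of `v` with a color in `I₂` satisfies `a(v) ≤ a(u) < λ`. -/
def OutReady {Δ N : ℕ} (P : Params Δ N) {V : Type*} [Fintype V] (G : SimpleGraph V)
    [DecidableRel G.Adj] (φ : V → ℕ) (v : V) : Prop :=
  ∀ u ∈ P.nbrs2 G φ v, P.a (φ v) ≤ P.a (φ u) ∧ P.a (φ u) < P.lam

/-- The first step of the transition-out stage: `d(v)` becomes some `i ∈ [μ]` that minimizes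
`|L_i(v) ∩ L(v)|`. -/
def OutPrepare {Δ N : ℕ} (P : Params Δ N) {V : Type*} [Fintype V] (G : SimpleGraph V)
    [DecidableRel G.Adj] (φ : V → ℕ) (v : V) (k' : ℕ) : Prop :=
  ∃ i < P.mu,
    (∀ j < P.mu, (P.L (φ v) i ∩ P.occupied G φ v).card ≤ (P.L (φ v) j ∩ P.occupied G φ v).card) ∧
    k' = P.encode (P.a (φ v)) (P.b (φ v)) (P.c (φ v)) i

/-- The last step of the transition-out stage: `v` moves to `I₃`. -/
def OutMove {Δ N : ℕ} (P : Params Δ N) {V : Type*} [Fintype V] (G : SimpleGraph V)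
    [DecidableRel G.Adj] (φ : V → ℕ) (v : V) (k' : ℕ) : Prop :=
  ∃ x : ℕ,
    IsLeast {y | y < P.mu ∧
      P.quad (φ v) (P.d (φ v)) y + P.mu * y ∈ P.L (φ v) (P.d (φ v)) ∧
      P.quad (φ v) (P.d (φ v)) y + P.mu * y ∉ P.occupied G φ v ∧
      ∀ u ∈ P.A G φ v, P.quad (φ v) (P.d (φ v)) y + P.mu * y ∉ P.L (φ u) (P.d (φ u))} x ∧
    k' = P.quad (φ v) (P.d (φ v)) x + P.mu * x

/-- The transition-out stage. -/
def TransitionOut {Δ N : ℕ} (P : Params Δ N) {V : Type*} [Fintype V] (G : SimpleGraph V)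
    [DecidableRel G.Adj] (φ : V → ℕ) (v : V) (k' : ℕ) : Prop :=
  (P.OutReady G φ v ∧ P.d (φ v) = P.mu → P.OutPrepare G φ v k') ∧
  (P.OutReady G φ v ∧ P.d (φ v) ≠ P.mu ∧ (∀ u ∈ P.A G φ v, P.d (φ u) ≠ P.mu) →
    P.OutMove G φ v k') ∧
  (¬ P.OutReady G φ v ∨ (P.d (φ v) ≠ P.mu ∧ ∃ u ∈ P.A G φ v, P.d (φ u) = P.mu) → k' = φ v)

/-- The standard reduction phase, which is run by the vertices that already have a color
in `I₃`. -/
def Standard {Δ N : ℕ} (P : Params Δ N) {V : Type*} (G : SimpleGraph V)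
    (φ : V → ℕ) (v : V) (k' : ℕ) : Prop :=
  ((∀ u, G.Adj v u → φ u ∈ P.I3 ∧ φ u < φ v) →
    IsLeast {x | x < Δ + 1 ∧ ∀ u, G.Adj v u → x ≠ φ u} k') ∧
  (¬ (∀ u, G.Adj v u → φ u ∈ P.I3 ∧ φ u < φ v) → k' = φ v)

/-- One round: all vertices simultaneously pass from the coloring `φ` to the coloring `φ'`, each
according to the interval that its own color lies in. -/
def Round {Δ N : ℕ} (P : Params Δ N) {V : Type*} [Fintype V] (G : SimpleGraph V)
    [DecidableRel G.Adj] (φ φ' : V → ℕ) : Prop :=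
  ∀ v,
    (φ v ∈ P.I1 → P.TransitionIn G φ v (φ' v)) ∧
    (φ v ∈ P.I2 → P.lam ≤ P.a (φ v) → P.Core G φ v (φ' v)) ∧
    (φ v ∈ P.I2 → P.a (φ v) < P.lam → P.TransitionOut G φ v (φ' v)) ∧
    (φ v ∈ P.I3 → P.Standard G φ v (φ' v))

end Algorithm

end Params

/-- Adjacent vertices have different colors. -/
def Proper {V : Type*} (G : SimpleGraph V) (φ : V → ℕ) : Prop := ∀ u v, G.Adj u v → φ u ≠ φ v

end LocIter

/-!
Everything is measured in powers of `q = Δ^{1/4}`, so that all numerical facts about the parameters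
become polynomial inequalities in `q` and logarithms.

*Existence.* Bertrand's postulate gives the primes. Graphs of polynomials of degree at most `D` over
`GF(p)` meet pairwise in at most `D` points, so `d` of them cannot meet each of the `p` points of
another one more than `ρ` times as soon as `d D < p (ρ + 1)` (`exists_unionCoverFree`). This yields
both set families, and the same bound on intersections is what makes `F_c` work.

*Transition-in.* A neighbor with the same new `a` lies in `N'(v, a)`, so the `a` values have defect
at most `Δ^{1/4}`, and the `b` values separate adjacent vertices with equal `a`
(`Params.Start.of_transitionIn`).

*Invariant.* The structure `Params.Inv` describes the state after `n` further rounds. Its key parts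
are that `(a, b)` is a proper coloring of the vertices in `I₂`, that `|A(v)| ≤ 2Δ^{1/4}`, and that a
vertex which has fixed its polynomial satisfies
`|L_{d(v)}(v) ∩ L(v)| + |A(v)| ≤ Δ/μ + 2Δ^{1/4}`. The latter sum never grows: a neighbor that moves
to `I₃` avoids `L_{d(v)}(v)` unless it lies in `A(v)`, and then it leaves `A(v)`
(`Params.card_inter_occupied_add_card_A_le`). The set `A(v)` of a settled vertex never grows either,
since a neighbor joining its class gets a larger `c`. The invariant makes every round feasible
(`Params.Inv.exists_round`), and `Params.Inv.outcome` together with `Params.Inv.step` carries it on.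

*Termination.* In the core stage `a = (â, ã)` moves along the line `ã + n â` over `GF(λ)`. Two
lines of different slope meet at most once, so each neighbor causes at most two conflicts within `λ`
rounds, one before and one after it settles; more than `Δ^{1/4}` conflicts in each of `λ` rounds
would be more than `2Δ` in total (`Params.a_lt_at_lam`). After that, two rounds suffice for each
`a` value, in increasing order (`Params.lt_a_of_two_rounds`).
-/

namespace LocIter

/-! ### Numerical facts about the parameters -/

lemma fourthRoot_pow (Δ : ℕ) : ((Δ : ℝ) ^ (1 / 4 : ℝ)) ^ 4 = Δ := by
  rw [← Real.rpow_natCast, ← Real.rpow_mul (by positivity)]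
  norm_num

lemma rpow_three_fourths (Δ : ℕ) : (Δ : ℝ) ^ (3 / 4 : ℝ) = ((Δ : ℝ) ^ (1 / 4 : ℝ)) ^ 3 := by
  rw [← Real.rpow_natCast, ← Real.rpow_mul (by positivity)]
  norm_num

lemma rpow_three_halves (Δ : ℕ) : (Δ : ℝ) ^ (3 / 2 : ℝ) = ((Δ : ℝ) ^ (1 / 4 : ℝ)) ^ 6 := by
  rw [← Real.rpow_natCast, ← Real.rpow_mul (by positivity)]
  norm_num

lemma sqrt_eq_fourthRoot_sq (Δ : ℕ) : √(Δ : ℝ) = ((Δ : ℝ) ^ (1 / 4 : ℝ)) ^ 2 := by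
  rw [← Real.rpow_natCast, ← Real.rpow_mul (by positivity), Real.sqrt_eq_rpow]
  norm_num

lemma one_le_fourthRoot {Δ : ℕ} (h : 1 ≤ Δ) : 1 ≤ (Δ : ℝ) ^ (1 / 4 : ℝ) :=
  Real.one_le_rpow (by exact_mod_cast h) (by norm_num)

lemma rho_le (Δ : ℕ) : (rho Δ : ℝ) ≤ (Δ : ℝ) ^ (1 / 4 : ℝ) :=
  Nat.floor_le (by positivity)

lemma lt_rho_add_one (Δ : ℕ) : (Δ : ℝ) ^ (1 / 4 : ℝ) < rho Δ + 1 := Nat.lt_floor_add_one _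

lemma one_le_logb {N : ℕ} (h : 2 ≤ N) : 1 ≤ Real.logb 2 N := by
  rw [Real.le_logb_iff_rpow_le (by norm_num) (by positivity)]
  simpa using (by exact_mod_cast h : (2 : ℝ) ≤ N)

lemma natLog_le_logb {n : ℕ} (h : n ≠ 0) : (Nat.log 2 n : ℝ) ≤ Real.logb 2 n := by
  rw [Real.le_logb_iff_rpow_le (by norm_num) (by positivity), Real.rpow_natCast]
  exact_mod_cast Nat.pow_log_le_self 2 h

lemma le_m1 (Δ N : ℕ) : 4 * ((Δ : ℝ) ^ (1 / 4 : ℝ)) ^ 6 * Real.logb 2 N ^ 2 ≤ m1 Δ N := by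
  rw [← rpow_three_halves]; exact Nat.le_ceil _

lemma m1_lt (Δ N : ℕ) : (m1 Δ N : ℝ) < 4 * ((Δ : ℝ) ^ (1 / 4 : ℝ)) ^ 6 * Real.logb 2 N ^ 2 + 1 := by
  rw [← rpow_three_halves]; exact Nat.ceil_lt_add_one (by positivity)

lemma le_m2 (Δ N : ℕ) : 4 * ((Δ : ℝ) ^ (1 / 4 : ℝ)) ^ 2 * Real.logb 2 N ^ 2 ≤ m2 Δ N := by
  rw [← sqrt_eq_fourthRoot_sq]; exact Nat.le_ceil _

lemma m2_lt (Δ N : ℕ) : (m2 Δ N : ℝ) < 4 * ((Δ : ℝ) ^ (1 / 4 : ℝ)) ^ 2 * Real.logb 2 N ^ 2 + 1 := by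
  rw [← sqrt_eq_fourthRoot_sq]; exact Nat.ceil_lt_add_one (by positivity)

lemma le_m3 (Δ N lam : ℕ) : 16 * ((Δ : ℝ) ^ (1 / 4 : ℝ)) ^ 2 *
    Real.logb 2 ((lam : ℝ) ^ 2 * m2 Δ N) ^ 2 ≤ m3 Δ N lam := by
  rw [← sqrt_eq_fourthRoot_sq]; exact Nat.le_ceil _

lemma m3_lt (Δ N lam : ℕ) : (m3 Δ N lam : ℝ) < 16 * ((Δ : ℝ) ^ (1 / 4 : ℝ)) ^ 2 *
    Real.logb 2 ((lam : ℝ) ^ 2 * m2 Δ N) ^ 2 + 1 := by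
  rw [← sqrt_eq_fourthRoot_sq]; exact Nat.ceil_lt_add_one (by positivity)

lemma four_le_m2 {Δ N : ℕ} (hΔ : 1 ≤ Δ) (hN : 2 ≤ N) : 4 ≤ m2 Δ N := by
  have h := le_m2 Δ N
  have h1 := one_le_fourthRoot hΔ
  have h2 := one_le_logb hN
  have h3 : (1 : ℝ) ≤ ((Δ : ℝ) ^ (1 / 4 : ℝ)) ^ 2 := one_le_pow₀ h1
  have h4 : (1 : ℝ) ≤ Real.logb 2 N ^ 2 := one_le_pow₀ h2
  have : (4 : ℝ) ≤ m2 Δ N := by nlinarith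
  exact_mod_cast this

/-- The index range `[λ² m₂]` of `F_c` has at least four elements, so its logarithm is at
least `2`. -/
lemma two_le_logb_mul {Δ N lam : ℕ} (hΔ : 1 ≤ Δ) (hN : 2 ≤ N) (hl : 1 ≤ lam) :
    2 ≤ Real.logb 2 ((lam : ℝ) ^ 2 * m2 Δ N) := by
  have h : (4 : ℝ) ≤ m2 Δ N := by exact_mod_cast four_le_m2 hΔ hN
  have h2 : (1 : ℝ) ≤ (lam : ℝ) ^ 2 := one_le_pow₀ (by exact_mod_cast hl)
  rw [Real.le_logb_iff_rpow_le (by norm_num) (by nlinarith)]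
  norm_num
  nlinarith

lemma le_sqrt_m1 (Δ N : ℕ) (hN : 2 ≤ N) :
    2 * ((Δ : ℝ) ^ (1 / 4 : ℝ)) ^ 3 * Real.logb 2 N ≤ √(m1 Δ N : ℝ) := by
  have := one_le_logb hN
  apply Real.le_sqrt_of_sq_le
  refine le_trans (le_of_eq ?_) (le_m1 Δ N)
  ring

lemma le_sqrt_m3 {Δ N lam : ℕ} (hΔ : 1 ≤ Δ) (hN : 2 ≤ N) (hl : 1 ≤ lam) :
    4 * (Δ : ℝ) ^ (1 / 4 : ℝ) * Real.logb 2 ((lam : ℝ) ^ 2 * m2 Δ N) ≤ √(m3 Δ N lam : ℝ) := by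
  have := two_le_logb_mul hΔ hN hl
  apply Real.le_sqrt_of_sq_le
  refine le_trans (le_of_eq ?_) (le_m3 Δ N lam)
  ring

namespace Params

variable {Δ N : ℕ} (P : Params Δ N)

lemma m1_lt_sq : m1 Δ N < P.lam ^ 2 := by
  have h := P.lam_gt
  have h0 : √(m1 Δ N : ℝ) < P.lam := by linarith
  have h1 := (Real.sqrt_lt' (by linarith [Real.sqrt_nonneg (m1 Δ N : ℝ)])).1 h0
  exact_mod_cast h1

/-- A starting palette of `N ≤ 4(Δ+1)²` colors is no larger than `[λ² m₂]`. -/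
lemma logb_le (hΔ : 1 ≤ Δ) (hN : 2 ≤ N) (hN' : N ≤ 4 * (Δ + 1) ^ 2) :
    Real.logb 2 N ≤ Real.logb 2 ((P.lam : ℝ) ^ 2 * m2 Δ N) := by
  have hq := one_le_fourthRoot hΔ
  have hL := one_le_logb hN
  have hL2 : (1 : ℝ) ≤ Real.logb 2 N ^ 2 := one_le_pow₀ hL
  have h1 : (m1 Δ N : ℝ) ≤ (P.lam : ℝ) ^ 2 := by exact_mod_cast P.m1_lt_sq.le
  have h2 := le_m1 Δ N
  have h3 := le_m2 Δ N
  have h4 := fourthRoot_pow Δ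
  have hΔ' : (1 : ℝ) ≤ Δ := by exact_mod_cast hΔ
  set q := (Δ : ℝ) ^ (1 / 4 : ℝ)
  have h5 : 4 * q ^ 6 ≤ (P.lam : ℝ) ^ 2 := by
    nlinarith [show (0 : ℝ) ≤ q ^ 6 by positivity]
  have h6 : 4 * q ^ 2 ≤ (m2 Δ N : ℝ) := by
    nlinarith [show (0 : ℝ) ≤ q ^ 2 by positivity]
  have h7 : (4 * q ^ 6) * (4 * q ^ 2) ≤ (P.lam : ℝ) ^ 2 * m2 Δ N := by gcongr
  have h8 : (4 * q ^ 6) * (4 * q ^ 2) = 16 * (Δ : ℝ) ^ 2 := by rw [← h4]; ring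
  have h9 : (N : ℝ) ≤ 4 * ((Δ : ℝ) + 1) ^ 2 := by exact_mod_cast hN'
  apply Real.logb_le_logb_of_le (by norm_num) (by positivity)
  nlinarith

/-- The `b` values coming from `F_b` lie in `[τ²]`, like those coming from `F_c`. -/
lemma m2_le_tau_sq (hΔ : 1 ≤ Δ) (hN : 2 ≤ N) (hN' : N ≤ 4 * (Δ + 1) ^ 2) :
    m2 Δ N ≤ P.tau ^ 2 := by
  have h1 := P.logb_le hΔ hN hN'
  have h2 := P.tau_gt
  have hq := one_le_fourthRoot hΔ
  have hL := one_le_logb hN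
  rw [m2, Nat.ceil_le, sqrt_eq_fourthRoot_sq]
  push_cast
  set q := (Δ : ℝ) ^ (1 / 4 : ℝ)
  have h3 : 2 * q * Real.logb 2 N ≤ P.tau := le_trans (by gcongr) h2.le
  have h4 : (2 * q * Real.logb 2 N) ^ 2 ≤ (P.tau : ℝ) ^ 2 := by gcongr
  nlinarith

lemma tau_le_sqrt (hΔ : 1 ≤ Δ) (hN : 2 ≤ N) : (P.tau : ℝ) ≤ √(m3 Δ N P.lam : ℝ) := by
  have h1 := le_sqrt_m3 hΔ hN P.lam_prime.one_lt.le
  have h2 := P.tau_le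
  linarith

lemma tau_sq_le_m3 (hΔ : 1 ≤ Δ) (hN : 2 ≤ N) : P.tau ^ 2 ≤ m3 Δ N P.lam := by
  have h1 := P.tau_le_sqrt hΔ hN
  have h2 := (Real.le_sqrt (by positivity) (by positivity)).1 h1
  exact_mod_cast h2

lemma tau_le_mu (hΔ : 1 ≤ Δ) (hN : 2 ≤ N) : P.tau ≤ P.mu := by
  have h1 := P.tau_le_sqrt hΔ hN
  have h2 := P.mu_gt
  have : (P.tau : ℝ) ≤ P.mu := by linarith [Real.sqrt_nonneg (Δ : ℝ)]
  exact_mod_cast this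

/-- Room in a member of `F_c`: its `τ` elements cannot be exhausted by `2Δ^{1/4}` members that
meet it in at most `log (λ² m₂)` elements each. -/
lemma two_rho_mul_log_lt_tau (hΔ : 1 ≤ Δ) (hN : 2 ≤ N) :
    2 * rho Δ * Nat.log 2 (P.lam ^ 2 * m2 Δ N) < P.tau := by
  have h0 : P.lam ^ 2 * m2 Δ N ≠ 0 := by
    have := four_le_m2 hΔ hN
    have := P.lam_prime.pos
    positivity
  have h1 := natLog_le_logb h0
  have h2 := P.tau_gt
  have h3 := rho_le Δ
  have h4 : (2 * rho Δ * Nat.log 2 (P.lam ^ 2 * m2 Δ N) : ℝ) < P.tau := by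
    refine lt_of_le_of_lt ?_ h2
    push_cast at h1
    gcongr
  exact_mod_cast h4

lemma one_le_log (hΔ : 1 ≤ Δ) (hN : 2 ≤ N) : 1 ≤ Nat.log 2 (P.lam ^ 2 * m2 Δ N) := by
  have h1 := four_le_m2 hΔ hN
  have h2 := P.lam_prime.pos
  apply Nat.log_pos (by norm_num)
  nlinarith [Nat.one_le_pow 2 P.lam h2]

lemma four_mul_rho_lt_sqrt_m3 (hΔ : 1 ≤ Δ) (hN : 2 ≤ N) :
    4 * (rho Δ : ℝ) < √(m3 Δ N P.lam : ℝ) := by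
  have h1 := le_sqrt_m3 hΔ hN P.lam_prime.one_lt.le
  have h2 := two_le_logb_mul hΔ hN P.lam_prime.one_lt.le
  have h3 := rho_le Δ
  have hq := one_le_fourthRoot hΔ
  nlinarith

/-- The excluded parameters `x` of `L_i` do not exhaust `[μ]`. -/
lemma div_add_lt_mu (hΔ : 1 ≤ Δ) (hN : 2 ≤ N) : Δ / P.mu + 4 * rho Δ < P.mu := by
  have h1 := P.four_mul_rho_lt_sqrt_m3 hΔ hN
  have h2 := P.mu_gt
  have hs := Real.sq_sqrt (show (0 : ℝ) ≤ Δ by positivity)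
  have hs0 := Real.sqrt_nonneg (Δ : ℝ)
  have hm : (0 : ℝ) < P.mu := by exact_mod_cast P.mu_prime.pos
  have h3 : ((Δ / P.mu : ℕ) : ℝ) ≤ √(Δ : ℝ) := by
    refine le_trans Nat.cast_div_le ?_
    rw [div_le_iff₀ hm]
    nlinarith [Real.sqrt_nonneg (m3 Δ N P.lam : ℝ)]
  have : ((Δ / P.mu : ℕ) : ℝ) + 4 * rho Δ < P.mu := by linarith
  exact_mod_cast this

/-- The excluded parameters `x` of `L_i` do not exhaust those whose colors lie in `I₃`. -/
lemma mul_mu_le_ell3 (hΔ : 1 ≤ Δ) (hN : 2 ≤ N) :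
    (Δ / P.mu + 4 * rho Δ + 1) * P.mu ≤ P.ell3 := by
  have h1 := P.four_mul_rho_lt_sqrt_m3 hΔ hN
  have hm : (0 : ℝ) < P.mu := by exact_mod_cast P.mu_prime.pos
  have h2 : ((Δ / P.mu : ℕ) : ℝ) * P.mu ≤ Δ := by exact_mod_cast Nat.div_mul_le_self _ _
  have h3 : (4 * (rho Δ : ℝ) + 1) * P.mu ≤ (2 * √(m3 Δ N P.lam : ℝ) + 1) * P.mu := by
    refine mul_le_mul_of_nonneg_right ?_ hm.le
    linarith [Real.sqrt_nonneg (m3 Δ N P.lam : ℝ)]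
  have h4 : (((Δ / P.mu + 4 * rho Δ + 1) * P.mu : ℕ) : ℝ) ≤ P.ell3 := by
    refine le_trans ?_ (Nat.le_ceil _)
    push_cast
    linarith
  exact_mod_cast h4

lemma lt_ell3 (hΔ : 1 ≤ Δ) (hN : 2 ≤ N) : Δ < P.ell3 := by
  have h1 := P.mul_mu_le_ell3 hΔ hN
  have h2 := Nat.lt_div_mul_add (a := Δ) P.mu_prime.pos
  nlinarith [Nat.zero_le (rho Δ * P.mu)]

/-- Two conflicts per neighbor are too few for more than `Δ^{1/4}` conflicts in each of `λ`
rounds. -/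
lemma two_mul_lt_lam_mul (hΔ : 1 ≤ Δ) (hN : 2 ≤ N) : 2 * Δ < P.lam * (rho Δ + 1) := by
  have h1 := le_sqrt_m1 Δ N hN
  have h2 := P.lam_gt
  have h3 := lt_rho_add_one Δ
  have h4 := fourthRoot_pow Δ
  have hL := one_le_logb hN
  have hq := one_le_fourthRoot hΔ
  set q := (Δ : ℝ) ^ (1 / 4 : ℝ)
  have h5 : 2 * q ^ 3 < P.lam := by nlinarith [show (0 : ℝ) ≤ q ^ 3 by positivity]
  have h6 : (2 * q ^ 3) * q < P.lam * (rho Δ + 1) :=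
    mul_lt_mul'' h5 h3 (by positivity) (by positivity)
  have : (2 * Δ : ℝ) < P.lam * (rho Δ + 1) := by rw [← h4]; linarith
  exact_mod_cast this

/-! ### Coordinates of colors -/

/-- The color `ℓ₃ + ⟨a, b, c, d⟩` with coordinates in their ranges lies in `I₂` and has these
coordinates. -/
lemma encode_spec {a b c d : ℕ} (ha : a < P.lam ^ 2) (hb : b < m3 Δ N P.lam)
    (hc : c < 2 * P.lam) (hd : d < P.mu + 1) :
    P.encode a b c d ∈ P.I2 ∧ P.a (P.encode a b c d) = a ∧ P.b (P.encode a b c d) = b ∧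
      P.c (P.encode a b c d) = c ∧ P.d (P.encode a b c d) = d := by
  set m := m3 Δ N P.lam with hm
  have e1 : c * (P.mu + 1) + d < 2 * P.lam * (P.mu + 1) := by nlinarith
  have e2 : b * (2 * P.lam * (P.mu + 1)) + (c * (P.mu + 1) + d)
      < 2 * P.lam * (P.mu + 1) * m := by
    have := Nat.mul_le_mul_right (2 * P.lam * (P.mu + 1)) (Nat.succ_le_of_lt hb)
    rw [Nat.succ_mul] at this
    linarith
  have e : P.encode a b c d - P.ell3 = (2 * P.lam * (P.mu + 1) * m) * a +
      (b * (2 * P.lam * (P.mu + 1)) + (c * (P.mu + 1) + d)) := by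
    rw [encode, Nat.add_sub_cancel_left]; ring
  have e' : P.encode a b c d - P.ell3 = (2 * P.lam * (P.mu + 1)) * (a * m + b) +
      (c * (P.mu + 1) + d) := by rw [e]; ring
  have e'' : P.encode a b c d - P.ell3 = (P.mu + 1) * ((2 * P.lam) * (a * m + b) + c) + d := by
    rw [e]; ring
  have p1 : 0 < 2 * P.lam * (P.mu + 1) := by omega
  refine ⟨?_, ?_, ?_, ?_, ?_⟩
  · rw [I2, Finset.mem_Ico]
    refine ⟨Nat.le_add_right _ _, ?_⟩
    have : P.encode a b c d - P.ell3 < P.ell2 := by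
      rw [e, ell2]
      have : (2 * P.lam * (P.mu + 1) * m) * (a + 1) ≤ (2 * P.lam * (P.mu + 1) * m) * P.lam ^ 2 :=
        Nat.mul_le_mul_left _ ha
      calc _ < (2 * P.lam * (P.mu + 1) * m) * (a + 1) := by
              linarith [mul_add_one (2 * P.lam * (P.mu + 1) * m) a]
        _ ≤ _ := this
        _ = _ := by ring
    omega
  · rw [Params.a, e, ← hm, Nat.mul_add_div (by omega), Nat.div_eq_of_lt e2, add_zero]
  · rw [Params.b, e, ← hm, Nat.mul_add_mod, Nat.mod_eq_of_lt e2, Nat.mul_comm b,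
      Nat.mul_add_div p1, Nat.div_eq_of_lt e1, add_zero]
  · rw [Params.c, e', Nat.mul_add_mod, Nat.mod_eq_of_lt e1, Nat.mul_comm c,
      Nat.mul_add_div (by omega), Nat.div_eq_of_lt hd, add_zero]
  · rw [Params.d, e'', Nat.mul_add_mod, Nat.mod_eq_of_lt hd]

lemma a_lt {k : ℕ} (hk : k ∈ P.I2) : P.a k < P.lam ^ 2 := by
  rw [I2, Finset.mem_Ico, ell2] at hk
  rw [Params.a]
  apply Nat.div_lt_of_lt_mul
  have : 2 * P.lam ^ 3 * (P.mu + 1) * m3 Δ N P.lam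
    = 2 * P.lam * (P.mu + 1) * m3 Δ N P.lam * P.lam ^ 2 := by ring
  omega

lemma d_lt (k : ℕ) : P.d k < P.mu + 1 := Nat.mod_lt _ (Nat.succ_pos _)

lemma c_lt (k : ℕ) : P.c k < 2 * P.lam := by
  have := P.lam_prime.pos
  rw [Params.c]
  apply Nat.div_lt_of_lt_mul
  rw [mul_comm (P.mu + 1)]
  exact Nat.mod_lt _ (by positivity)

lemma aHat_lt {k : ℕ} (hk : k ∈ P.I2) : P.aHat k < P.lam := by
  rw [aHat]
  apply Nat.div_lt_of_lt_mul
  rw [← sq]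
  exact P.a_lt hk

lemma aTilde_lt (k : ℕ) : P.aTilde k < P.lam := Nat.mod_lt _ P.lam_prime.pos

lemma aHat_mul_add_aTilde (k : ℕ) : P.aHat k * P.lam + P.aTilde k = P.a k :=
  Nat.div_add_mod' _ _

lemma aHat_eq_zero_iff (k : ℕ) : P.aHat k = 0 ↔ P.a k < P.lam := by
  rw [aHat, Nat.div_eq_zero_iff]
  have := P.lam_prime.pos
  omega

lemma aTilde_of_lt {k : ℕ} (h : P.a k < P.lam) : P.aTilde k = P.a k := Nat.mod_eq_of_lt h

lemma not_mem_I3_of_mem_I2 {k : ℕ} (h : k ∈ P.I2) : k ∉ P.I3 := by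
  simp only [I2, I3, Finset.mem_Ico, Finset.mem_range] at *; omega

lemma not_mem_I1_of_mem_I2 {k : ℕ} (h : k ∈ P.I2) : k ∉ P.I1 := by
  simp only [I2, I1, Finset.mem_Ico] at *; omega

lemma not_mem_I1_of_mem_I3 {k : ℕ} (h : k ∈ P.I3) : k ∉ P.I1 := by
  simp only [I3, I1, Finset.mem_Ico, Finset.mem_range] at *; omega

end Params

/-! ### Set families from graphs of polynomials -/

/-- The graph of the polynomial `p` over `GF(q)` as a subset of `[q²]`, the point `(x, y)` being
encoded as `x q + y`. -/
noncomputable def polyGraph {q : ℕ} (p : Polynomial (ZMod q)) : Finset ℕ :=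
  (Finset.range q).image (fun x : ℕ => x * q + ZMod.val (p.eval (x : ZMod q)))

lemma mem_polyGraph {q : ℕ} [NeZero q] {p : Polynomial (ZMod q)} {y : ℕ} :
    y ∈ polyGraph p ↔ y / q < q ∧ y % q = ZMod.val (p.eval ((y / q : ℕ) : ZMod q)) := by
  have hq := NeZero.pos q
  simp only [polyGraph, Finset.mem_image, Finset.mem_range]
  constructor
  · rintro ⟨x, hx, rfl⟩
    have h := ZMod.val_lt (p.eval (x : ZMod q))
    have h1 : (x * q + ZMod.val (p.eval (x : ZMod q))) / q = x := by
      rw [mul_comm, Nat.mul_add_div hq, Nat.div_eq_of_lt h, add_zero]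
    rw [h1]
    refine ⟨hx, ?_⟩
    rw [mul_comm, Nat.mul_add_mod, Nat.mod_eq_of_lt h]
  · rintro ⟨h1, h2⟩
    exact ⟨y / q, h1, by rw [← h2, Nat.div_add_mod']⟩

lemma polyGraph_subset {q : ℕ} [NeZero q] (p : Polynomial (ZMod q)) :
    polyGraph p ⊆ Finset.range (q ^ 2) := by
  intro y hy
  rw [mem_polyGraph] at hy
  rw [Finset.mem_range, sq]
  exact Nat.lt_mul_of_div_lt hy.1 (NeZero.pos q)

lemma card_polyGraph {q : ℕ} [NeZero q] (p : Polynomial (ZMod q)) : (polyGraph p).card = q := by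
  rw [polyGraph, Finset.card_image_of_injOn, Finset.card_range]
  intro x _ y _ hxy
  have hx := ZMod.val_lt (p.eval (x : ZMod q))
  have hy := ZMod.val_lt (p.eval (y : ZMod q))
  have h := congrArg (· / q) hxy
  simpa [mul_comm _ q, Nat.mul_add_div (NeZero.pos q), Nat.div_eq_of_lt hx,
    Nat.div_eq_of_lt hy] using h

lemma card_polyGraph_inter_le {q D : ℕ} [Fact q.Prime] {p p' : Polynomial (ZMod q)}
    (hne : p ≠ p') (hp : p.natDegree ≤ D) (hp' : p'.natDegree ≤ D) :
    (polyGraph p ∩ polyGraph p').card ≤ D := by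
  have hmaps : ∀ y ∈ polyGraph p ∩ polyGraph p',
      ((y / q : ℕ) : ZMod q) ∈ (p - p').roots.toFinset := by
    intro y hy
    rw [Finset.mem_inter, mem_polyGraph, mem_polyGraph] at hy
    rw [Multiset.mem_toFinset, Polynomial.mem_roots (sub_ne_zero.2 hne), Polynomial.IsRoot,
      Polynomial.eval_sub, sub_eq_zero]
    exact ZMod.val_injective q (hy.1.2.symm.trans hy.2.2)
  refine (Finset.card_le_card_of_injOn _ hmaps ?_).trans ?_
  · intro y hy z hz hyz
    rw [Finset.mem_coe, Finset.mem_inter, mem_polyGraph, mem_polyGraph] at hy hz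
    have h1 : y / q = z / q := by
      have := (ZMod.natCast_eq_natCast_iff' _ _ _).1 hyz
      rwa [Nat.mod_eq_of_lt hy.1.1, Nat.mod_eq_of_lt hz.1.1] at this
    have h2 : y % q = z % q := by rw [hy.1.2, hz.1.2, h1]
    rw [← Nat.div_add_mod' y q, ← Nat.div_add_mod' z q, h1, h2]
  · exact (Multiset.toFinset_card_le _).trans ((Polynomial.card_roots' _).trans
      ((Polynomial.natDegree_sub_le _ _).trans (max_le hp hp')))

lemma exists_poly_injOn (q D : ℕ) [Fact q.Prime] : ∃ p : ℕ → Polynomial (ZMod q),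
    (∀ i, (p i).natDegree ≤ D) ∧ Set.InjOn p (Set.Iio (q ^ (D + 1))) := by
  have e : Fin (q ^ (D + 1)) ≃ (Fin (D + 1) → ZMod q) :=
    Fintype.equivOfCardEq (by simp [ZMod.card])
  have hq : 0 < q ^ (D + 1) := pow_pos (NeZero.pos q) _
  refine ⟨fun i => (Polynomial.degreeLTEquiv (ZMod q) (D + 1)).symm
    (e ⟨i % q ^ (D + 1), Nat.mod_lt _ hq⟩), fun i => ?_, ?_⟩
  · rw [← Nat.lt_succ_iff]
    set p := (Polynomial.degreeLTEquiv (ZMod q) (D + 1)).symm (e ⟨i % q ^ (D + 1), Nat.mod_lt _ hq⟩)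
    have := Polynomial.mem_degreeLT.1 p.2
    by_cases h0 : (p : Polynomial (ZMod q)) = 0
    · change (p : Polynomial (ZMod q)).natDegree < D + 1
      simp [h0]
    · exact (Polynomial.natDegree_lt_iff_degree_lt h0).2 this
  · intro i hi j hj hij
    have h1 := e.injective ((LinearEquiv.injective _) (Subtype.ext hij))
    rw [Fin.mk.injEq, Nat.mod_eq_of_lt hi, Nat.mod_eq_of_lt hj] at h1
    exact h1

lemma coverFree_of_unionCoverFree {d N : ℕ} {F : ℕ → Finset ℕ} (h : UnionCoverFree d 0 N F) :
    CoverFree d N F := by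
  intro i hi f hf
  obtain ⟨x, hx, hc⟩ := h i hi f hf
  refine ⟨x, hx, fun j hj => ?_⟩
  rw [Nat.le_zero, Finset.card_eq_zero] at hc
  exact Finset.notMem_empty j (hc ▸ Finset.mem_filter.2 ⟨Finset.mem_univ j, hj⟩)

/-- Graphs of polynomials of degree at most `D` over `GF(q)` meet pairwise in at most `D` points.
So `d` of them meet a further one at most `d D` times in total, and if this is less than
`q (ρ+1)`, one of its `q` points is met at most `ρ` times. -/
lemma exists_unionCoverFree {q D N d ρ m : ℕ} (hq : q.Prime) (hD : D < q) (hN : N ≤ q ^ (D + 1))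
    (hd : d * D < q * (ρ + 1)) (hm : q ^ 2 ≤ m) :
    ∃ F, IsSetSystem N m F ∧ UnionCoverFree d ρ N F := by
  have : Fact q.Prime := ⟨hq⟩
  obtain ⟨p, hp, hinj⟩ := exists_poly_injOn q D
  have hint : ∀ i < N, ∀ j < N, i ≠ j → (polyGraph (p i) ∩ polyGraph (p j)).card ≤ D :=
    fun i hi j hj hij => card_polyGraph_inter_le
      (fun h => hij (hinj (lt_of_lt_of_le hi hN) (lt_of_lt_of_le hj hN) h)) (hp i) (hp j)
  refine ⟨fun i => polyGraph (p i), ⟨fun i _ => ?_, ?_⟩, ?_⟩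
  · exact (polyGraph_subset _).trans (Finset.range_subset_range.2 hm)
  · intro i hi j hj hij
    by_contra hne
    have h := hint i hi j hj hne
    have hij' : polyGraph (p i) = polyGraph (p j) := hij
    rw [hij', Finset.inter_self, card_polyGraph] at h
    omega
  · intro i hi f hf
    by_contra! hcon
    have h1 : q * (ρ + 1) ≤ ∑ x ∈ polyGraph (p i),
        (Finset.univ.filter (fun j : Fin d => x ∈ polyGraph (p (f j)))).card := by
      calc q * (ρ + 1) = ∑ x ∈ polyGraph (p i), (ρ + 1) := by
            rw [Finset.sum_const, card_polyGraph, smul_eq_mul]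
        _ ≤ _ := Finset.sum_le_sum fun x hx => hcon x hx
    have h2 : ∑ x ∈ polyGraph (p i),
        (Finset.univ.filter (fun j : Fin d => x ∈ polyGraph (p (f j)))).card =
        ∑ j : Fin d, (polyGraph (p i) ∩ polyGraph (p (f j))).card := by
      refine (Finset.sum_card_bipartiteAbove_eq_sum_card_bipartiteBelow
        (s := polyGraph (p i)) (t := (Finset.univ : Finset (Fin d)))
        (fun x j => x ∈ polyGraph (p (f j)))).trans (Finset.sum_congr rfl fun j _ => ?_)
      rw [Finset.bipartiteBelow, Finset.filter_mem_eq_inter]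
    have h3 : ∑ j : Fin d, (polyGraph (p i) ∩ polyGraph (p (f j))).card ≤ d * D := by
      refine (Finset.sum_le_card_nsmul _ _ D fun j _ =>
        hint i hi _ (hf j).1 (hf j).2.symm).trans ?_
      simp
    omega

/-! ### Existence of the parameters -/

lemma exists_prime_gt_le_two_mul {x : ℝ} (hx : 1 ≤ x) :
    ∃ p : ℕ, p.Prime ∧ x < p ∧ (p : ℝ) ≤ 2 * x := by
  have h0 : ⌊x⌋₊ ≠ 0 := (Nat.floor_pos.2 hx).ne'
  obtain ⟨p, hp, h1, h2⟩ := Nat.exists_prime_lt_and_le_two_mul _ h0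
  refine ⟨p, hp, (Nat.floor_lt (by linarith)).1 h1, ?_⟩
  have h3 : (p : ℝ) ≤ 2 * ⌊x⌋₊ := by exact_mod_cast h2
  linarith [Nat.floor_le (show 0 ≤ x by linarith)]

lemma lt_pow_log_add_one {n q : ℕ} (hq : 2 ≤ q) : n < q ^ (Nat.log 2 n + 1) :=
  (Nat.lt_pow_succ_log_self (by norm_num) n).trans_le (Nat.pow_le_pow_left hq _)

lemma exists_Fa {Δ N : ℕ} (hΔ : 1 ≤ Δ) (hN : 2 ≤ N) :
    ∃ F, IsSetSystem N (m1 Δ N) F ∧ UnionCoverFree Δ (rho Δ) N F := by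
  have hq := one_le_fourthRoot hΔ
  have hL := one_le_logb hN
  have h4 := fourthRoot_pow Δ
  have h3 := lt_rho_add_one Δ
  have hD := natLog_le_logb (n := N) (by omega)
  have hm := le_m1 Δ N
  set q := (Δ : ℝ) ^ (1 / 4 : ℝ)
  set D := Nat.log 2 N
  set ell := Real.logb 2 N
  -- A prime `p` just above `Δ^{3/4} log N` has `p² ≤ m₁`, and `Δ log N ≤ Δ^{1/4} p < (ρ + 1) p`.
  have hq3 : 1 ≤ q ^ 3 := one_le_pow₀ hq
  have hx : 1 ≤ q ^ 3 * ell := by nlinarith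
  obtain ⟨p, hp, hp1, hp2⟩ := exists_prime_gt_le_two_mul hx
  refine exists_unionCoverFree (D := D) hp ?_ (lt_pow_log_add_one hp.two_le).le ?_ ?_
  · have : (D : ℝ) < p := by nlinarith
    exact_mod_cast this
  · have : (Δ : ℝ) * D < p * (rho Δ + 1) := by
      rw [← h4]
      calc q ^ 4 * D ≤ (q ^ 3 * ell) * q := by
            rw [show q ^ 3 * ell * q = q ^ 4 * ell by ring]; gcongr
        _ < _ := mul_lt_mul'' hp1 h3 (by positivity) (by positivity)
    exact_mod_cast this
  · have : (p : ℝ) ^ 2 ≤ m1 Δ N := by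
      refine le_trans ?_ hm
      calc (p : ℝ) ^ 2 ≤ (2 * (q ^ 3 * ell)) ^ 2 := by gcongr
        _ = _ := by ring
    exact_mod_cast this

lemma exists_Fb {Δ N : ℕ} (hΔ : 1 ≤ Δ) (hN : 2 ≤ N) :
    ∃ F, IsSetSystem N (m2 Δ N) F ∧ CoverFree (rho Δ) N F := by
  have hq := one_le_fourthRoot hΔ
  have hL := one_le_logb hN
  have h3 := rho_le Δ
  have hD := natLog_le_logb (n := N) (by omega)
  have hm := le_m2 Δ N
  set q := (Δ : ℝ) ^ (1 / 4 : ℝ)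
  set D := Nat.log 2 N
  set ell := Real.logb 2 N
  -- A prime `p` just above `Δ^{1/4} log N` has `p² ≤ m₂`, and `ρ log N < p`.
  have hx : 1 ≤ q * ell := by nlinarith
  obtain ⟨p, hp, hp1, hp2⟩ := exists_prime_gt_le_two_mul hx
  have key : ∃ F, IsSetSystem N (m2 Δ N) F ∧ UnionCoverFree (rho Δ) 0 N F := by
    refine exists_unionCoverFree (D := D) hp ?_ (lt_pow_log_add_one hp.two_le).le ?_ ?_
    · have : (D : ℝ) < p := by nlinarith
      exact_mod_cast this
    · have : (rho Δ : ℝ) * D < p := lt_of_le_of_lt (by gcongr) hp1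
      rw [zero_add, mul_one]
      exact_mod_cast this
    · have : (p : ℝ) ^ 2 ≤ m2 Δ N := by
        refine le_trans ?_ hm
        calc (p : ℝ) ^ 2 ≤ (2 * (q * ell)) ^ 2 := by gcongr
          _ = _ := by ring
      exact_mod_cast this
  obtain ⟨F, hF, hF'⟩ := key
  exact ⟨F, hF, coverFree_of_unionCoverFree hF'⟩

lemma nonempty_params {Δ N : ℕ} (hΔ : 1 ≤ Δ) (hN : 2 ≤ N) : Nonempty (Params Δ N) := by
  obtain ⟨Fa, hFa, hFa'⟩ := exists_Fa hΔ hN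
  obtain ⟨Fb, hFb, hFb'⟩ := exists_Fb hΔ hN
  obtain ⟨lam, hl, hl1, hl2⟩ := exists_prime_gt_le_two_mul
    (x := √(m1 Δ N : ℝ) + 1) (by linarith [Real.sqrt_nonneg (m1 Δ N : ℝ)])
  have hq := one_le_fourthRoot hΔ
  have hlog := two_le_logb_mul hΔ hN hl.one_lt.le
  obtain ⟨mu, hmu, hmu1, hmu2⟩ := exists_prime_gt_le_two_mul
    (x := √(Δ : ℝ) + √(m3 Δ N lam : ℝ)) (by
      have : (1 : ℝ) ≤ √(Δ : ℝ) := Real.one_le_sqrt.2 (by exact_mod_cast hΔ)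
      linarith [Real.sqrt_nonneg (m3 Δ N lam : ℝ)])
  obtain ⟨tau, ht, ht1, ht2⟩ := exists_prime_gt_le_two_mul
    (x := 2 * (Δ : ℝ) ^ (1 / 4 : ℝ) * Real.logb 2 ((lam : ℝ) ^ 2 * m2 Δ N)) (by nlinarith)
  have : Fact tau.Prime := ⟨ht⟩
  obtain ⟨p, hp, hinj⟩ := exists_poly_injOn tau (Nat.log 2 (lam ^ 2 * m2 Δ N))
  exact ⟨{
    lam := lam, mu := mu, tau := tau
    lam_prime := hl, mu_prime := hmu, tau_prime := ht
    lam_gt := hl1, lam_le := hl2, mu_gt := hmu1, mu_le := hmu2, tau_gt := ht1, tau_le := ht2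
    Fa := Fa, Fa_system := hFa, Fa_coverFree := hFa'
    Fb := Fb, Fb_system := hFb, Fb_coverFree := hFb'
    poly := p, poly_degree := fun i _ => hp i
    poly_inj := hinj.mono (Set.Iio_subset_Iio (lt_pow_log_add_one ht.two_le).le) }⟩

/-! ### The sizes of `λ` and of `I₃` -/

lemma logb_le_self {x : ℝ} (hx : 1 ≤ x) : Real.logb 2 x ≤ 2 * x := by
  have h := Real.log_le_sub_one_of_pos (show 0 < x by linarith)
  have h2 := Real.log_two_gt_d9
  rw [Real.logb, div_le_iff₀ (by linarith)]
  nlinarith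

namespace Params

variable {Δ N : ℕ} (P : Params Δ N)

lemma logb_palette_le (hΔ : 2 ≤ Δ) (hN : 2 ≤ N) (hN' : N ≤ 4 * (Δ + 1) ^ 2) :
    Real.logb 2 N ≤ 6 * Real.logb 2 Δ := by
  have hΔ' : (2 : ℝ) ≤ Δ := by exact_mod_cast hΔ
  have h1 : (N : ℝ) ≤ (Δ : ℝ) ^ 6 := by
    have h2 : (N : ℝ) ≤ 4 * ((Δ : ℝ) + 1) ^ 2 := by exact_mod_cast hN'
    have h3 : (16 : ℝ) ≤ (Δ : ℝ) ^ 4 := by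
      calc (16 : ℝ) = 2 ^ 4 := by norm_num
        _ ≤ _ := by gcongr
    nlinarith [sq_nonneg ((Δ : ℝ) - 2), sq_nonneg (Δ : ℝ)]
  calc Real.logb 2 N ≤ Real.logb 2 ((Δ : ℝ) ^ 6) :=
        Real.logb_le_logb_of_le (by norm_num) (by positivity) h1
    _ = _ := by rw [Real.logb_pow]; norm_num

lemma lam_le_bound (hΔ : 2 ≤ Δ) (hN : 2 ≤ N) (hN' : N ≤ 4 * (Δ + 1) ^ 2) :
    (P.lam : ℝ) ≤ 28 * (((Δ : ℝ) ^ (1 / 4 : ℝ)) ^ 3 * Real.logb 2 Δ) := by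
  have hlog := logb_palette_le hΔ hN hN'
  have hL := one_le_logb hN
  have hLΔ := one_le_logb hΔ
  have hq := one_le_fourthRoot (show 1 ≤ Δ by omega)
  have hm := m1_lt Δ N
  have hl := P.lam_le
  set q := (Δ : ℝ) ^ (1 / 4 : ℝ)
  have hq3 : 1 ≤ q ^ 3 := one_le_pow₀ hq
  have h1 : √(m1 Δ N : ℝ) ≤ 2 * q ^ 3 * Real.logb 2 N + 1 := by
    apply Real.sqrt_le_iff.2 ⟨by positivity, ?_⟩
    have : 0 ≤ q ^ 3 * Real.logb 2 N := by positivity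
    nlinarith
  have h2 : q ^ 3 * Real.logb 2 N ≤ q ^ 3 * (6 * Real.logb 2 Δ) := by gcongr
  have h3 : 1 ≤ q ^ 3 * Real.logb 2 Δ := one_le_mul_of_one_le_of_one_le hq3 hLΔ
  linarith

/-- Both `λ` and `m₂` are bounded by powers of `Δ`; numerical factors are absorbed by `2 ≤ Δ`. -/
lemma logb_index_le (hΔ : 2 ≤ Δ) (hN : 2 ≤ N) (hN' : N ≤ 4 * (Δ + 1) ^ 2) :
    Real.logb 2 ((P.lam : ℝ) ^ 2 * m2 Δ N) ≤ 30 * Real.logb 2 Δ := by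
  have hlog := logb_palette_le hΔ hN hN'
  have hL := one_le_logb hN
  have hLΔ := one_le_logb hΔ
  have hq := one_le_fourthRoot (show 1 ≤ Δ by omega)
  have hΔ' : (2 : ℝ) ≤ Δ := by exact_mod_cast hΔ
  have hm := m2_lt Δ N
  have hl := P.lam_le_bound hΔ hN hN'
  have h4 := fourthRoot_pow Δ
  have hle := logb_le_self (show (1 : ℝ) ≤ Δ by linarith)
  have hlp : (0 : ℝ) < P.lam := by exact_mod_cast P.lam_prime.pos
  have hm4 : (4 : ℝ) ≤ m2 Δ N := by exact_mod_cast four_le_m2 (by omega) hN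
  set q := (Δ : ℝ) ^ (1 / 4 : ℝ)
  have hqΔ : ∀ k ≤ 4, q ^ k ≤ (Δ : ℝ) := fun k hk => h4 ▸ pow_le_pow_right₀ hq hk
  have h1 : (P.lam : ℝ) ≤ (Δ : ℝ) ^ 8 := by
    calc (P.lam : ℝ) ≤ 28 * (Δ * (2 * Δ)) := hl.trans (by gcongr; exact hqΔ 3 (by norm_num))
      _ ≤ (2 : ℝ) ^ 6 * (Δ : ℝ) ^ 2 := by nlinarith
      _ ≤ (Δ : ℝ) ^ 6 * (Δ : ℝ) ^ 2 := by gcongr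
      _ = _ := by ring
  have h2 : (m2 Δ N : ℝ) ≤ (Δ : ℝ) ^ 14 := by
    have : Real.logb 2 N ^ 2 ≤ (6 * (2 * Δ)) ^ 2 := by gcongr; linarith
    calc (m2 Δ N : ℝ) ≤ 4 * Δ * (6 * (2 * Δ)) ^ 2 + 1 := hm.le.trans (by
          gcongr; exact hqΔ 2 (by norm_num))
      _ ≤ (2 : ℝ) ^ 11 * (Δ : ℝ) ^ 3 := by
          nlinarith [one_le_pow₀ (n := 3) (show (1 : ℝ) ≤ Δ by linarith)]
      _ ≤ (Δ : ℝ) ^ 11 * (Δ : ℝ) ^ 3 := by gcongr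
      _ = _ := by ring
  have h3 : (P.lam : ℝ) ^ 2 * m2 Δ N ≤ (Δ : ℝ) ^ 30 := by
    calc _ ≤ ((Δ : ℝ) ^ 8) ^ 2 * (Δ : ℝ) ^ 14 := by gcongr
      _ = _ := by ring
  calc _ ≤ Real.logb 2 ((Δ : ℝ) ^ 30) :=
        Real.logb_le_logb_of_le (by norm_num) (by positivity) h3
    _ = _ := by rw [Real.logb_pow]; norm_num

/-- With `√m₃ = O(Δ^{1/4} log Δ)` and `μ = O(√Δ)`, the latter because `log Δ = O(Δ^{1/4})`. -/
lemma card_I3_le_bound (hΔ : 2 ≤ Δ) (hN : 2 ≤ N) (hN' : N ≤ 4 * (Δ + 1) ^ 2) :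
    (P.I3.card : ℝ) ≤
      Δ + 500000 * (((Δ : ℝ) ^ (1 / 4 : ℝ)) ^ 3 * Real.logb 2 Δ) := by
  have hlog := P.logb_index_le hΔ hN hN'
  have hl2 := two_le_logb_mul (by omega) hN P.lam_prime.one_lt.le (Δ := Δ) (lam := P.lam)
  have hLΔ := one_le_logb hΔ
  have hq := one_le_fourthRoot (show 1 ≤ Δ by omega)
  have hm := m3_lt Δ N P.lam
  have hmu := P.mu_le
  have h4 := fourthRoot_pow Δ
  have hsq := sqrt_eq_fourthRoot_sq Δ
  rw [I3, Finset.card_range, ell3]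
  set q := (Δ : ℝ) ^ (1 / 4 : ℝ)
  set ell := Real.logb 2 Δ
  set s := √(m3 Δ N P.lam : ℝ)
  have hs0 : 0 ≤ s := Real.sqrt_nonneg _
  have hell : ell ≤ 8 * q := by
    have h := logb_le_self hq
    calc ell = Real.logb 2 (q ^ 4) := by rw [h4]
      _ = 4 * Real.logb 2 q := by rw [Real.logb_pow]; norm_num
      _ ≤ _ := by linarith
  have hqe : 1 ≤ q * ell := one_le_mul_of_one_le_of_one_le hq hLΔ
  have hs : s ≤ 121 * (q * ell) := by
    have h1 : s ≤ 4 * q * (30 * ell) + 1 := by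
      apply Real.sqrt_le_iff.2 ⟨by positivity, hm.le.trans ?_⟩
      have : 16 * q ^ 2 * Real.logb 2 ((P.lam : ℝ) ^ 2 * m2 Δ N) ^ 2
        ≤ 16 * q ^ 2 * (30 * ell) ^ 2 := by gcongr
      nlinarith
    linarith
  have hmu' : (P.mu : ℝ) ≤ 2 * (969 * q ^ 2) := by
    have : q * ell ≤ q * (8 * q) := by gcongr
    nlinarith
  have hceil := (Nat.ceil_lt_add_one (show 0 ≤ (Δ : ℝ) + (2 * s + 1) * P.mu by positivity)).le
  have hprod : (2 * s + 1) * P.mu ≤ (243 * (q * ell)) * (2 * (969 * q ^ 2)) := by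
    gcongr
    linarith
  have hlast : 1 ≤ q ^ 3 * ell := one_le_mul_of_one_le_of_one_le (one_le_pow₀ hq) hLΔ
  nlinarith

end Params

/-! ### Counting lemmas -/

lemma exists_isLeast {s : Set ℕ} (h : s.Nonempty) : ∃ x, IsLeast s x :=
  ⟨sInf s, Nat.sInf_mem h, fun _ hx => Nat.sInf_le hx⟩

/-- A family indexed by a finset with at most `d` elements can be listed as `f 0, …, f (d-1)`,
unused positions being filled with a given value `p`. -/
lemma exists_padding {V : Type*} (s : Finset V) {d : ℕ} (hs : s.card ≤ d) (g : V → ℕ) (p : ℕ) :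
    ∃ f : Fin d → ℕ, (∀ j, f j = p ∨ ∃ u ∈ s, f j = g u) ∧
      ∀ (Q : ℕ → Prop) [DecidablePred Q],
        (s.filter (fun u => Q (g u))).card ≤ (Finset.univ.filter (fun j => Q (f j))).card := by
  classical
  have e := s.equivFin
  refine ⟨fun j => if h : (j : ℕ) < s.card then g (e.symm ⟨j, h⟩) else p, fun j => ?_, ?_⟩
  · by_cases h : (j : ℕ) < s.card
    · right
      refine ⟨e.symm ⟨j, h⟩, (e.symm ⟨j, h⟩).2, ?_⟩
      simp [h]
    · left
      simp [h]
  · intro Q _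
    rcases s.eq_empty_or_nonempty with rfl | hne
    · simp
    refine Finset.card_le_card_of_injOn
      (fun u => if h : u ∈ s then Fin.castLE hs (e ⟨u, h⟩) else ⟨0, hne.card_pos.trans_le hs⟩) ?_ ?_
    · intro u hu
      rw [Finset.mem_coe, Finset.mem_filter] at hu
      simp [hu.1, hu.2]
    · intro u hu w hw huw
      rw [Finset.mem_coe, Finset.mem_filter] at hu hw
      simp only [hu.1, hw.1, dite_true, Fin.ext_iff, Fin.val_castLE] at huw
      exact congrArg Subtype.val (e.injective (Fin.ext huw))

lemma exists_mem_forall_not_mem {V : Type*} {S : Finset ℕ} {s : Finset V} {bad : V → Finset ℕ}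
    {D : ℕ} (h : ∀ u ∈ s, (S ∩ bad u).card ≤ D) (hD : s.card * D < S.card) :
    ∃ y ∈ S, ∀ u ∈ s, y ∉ bad u := by
  by_contra! hcon
  have h1 : S ⊆ s.biUnion (fun u => S ∩ bad u) := by
    intro y hy
    obtain ⟨u, hu, hyu⟩ := hcon y hy
    exact Finset.mem_biUnion.2 ⟨u, hu, Finset.mem_inter.2 ⟨hy, hyu⟩⟩
  have h2 := (Finset.card_le_card h1).trans (Finset.card_biUnion_le_card_mul _ _ _ h)
  omega

namespace Params

variable {Δ N : ℕ} (P : Params Δ N)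

/-! ### The sets `S_c` and `L_i` -/

lemma Sc_eq_polyGraph (i : ℕ) : P.Sc i = polyGraph (P.poly i) := rfl

lemma lt_of_mem_Sc {i y : ℕ} (h : y ∈ P.Sc i) : y < P.tau ^ 2 := by
  have : Fact P.tau.Prime := ⟨P.tau_prime⟩
  rw [Sc_eq_polyGraph] at h
  exact Finset.mem_range.1 (polyGraph_subset _ h)

lemma card_Sc (i : ℕ) : (P.Sc i).card = P.tau := by
  have : Fact P.tau.Prime := ⟨P.tau_prime⟩
  rw [Sc_eq_polyGraph, card_polyGraph]

lemma card_Sc_inter_le {i j : ℕ} (hi : i < P.lam ^ 2 * m2 Δ N) (hj : j < P.lam ^ 2 * m2 Δ N)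
    (hij : i ≠ j) : (P.Sc i ∩ P.Sc j).card ≤ Nat.log 2 (P.lam ^ 2 * m2 Δ N) := by
  have : Fact P.tau.Prime := ⟨P.tau_prime⟩
  exact card_polyGraph_inter_le (fun h => hij (P.poly_inj hi hj h)) (P.poly_degree i hi)
    (P.poly_degree j hj)

lemma scIdx_lt {k : ℕ} (hk : k ∈ P.I2) (hb : P.b k < m2 Δ N) :
    P.scIdx k < P.lam ^ 2 * m2 Δ N := by
  have h := Nat.mul_le_mul_right (m2 Δ N) (Nat.succ_le_of_lt (P.a_lt hk))
  rw [Nat.succ_mul] at h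
  rw [scIdx]
  omega

lemma a_eq_and_b_eq_of_scIdx_eq {k k' : ℕ} (hb : P.b k < m2 Δ N) (hb' : P.b k' < m2 Δ N)
    (h : P.scIdx k = P.scIdx k') : P.a k = P.a k' ∧ P.b k = P.b k' := by
  have hpos : 0 < m2 Δ N := by omega
  rw [scIdx, scIdx, mul_comm, mul_comm (P.a k')] at h
  have h1 := congrArg (· / m2 Δ N) h
  have h2 := congrArg (· % m2 Δ N) h
  simp only [Nat.mul_add_div hpos, Nat.div_eq_of_lt hb, Nat.div_eq_of_lt hb', add_zero] at h1
  simp only [Nat.mul_add_mod, Nat.mod_eq_of_lt hb, Nat.mod_eq_of_lt hb'] at h2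
  exact ⟨h1, h2⟩

lemma quad_lt (k i x : ℕ) : P.quad k i x < P.mu := Nat.mod_lt _ P.mu_prime.pos

lemma quad_add_mul_div (k i x : ℕ) : (P.quad k i x + P.mu * x) / P.mu = x := by
  rw [Nat.add_mul_div_left _ _ P.mu_prime.pos, Nat.div_eq_of_lt (P.quad_lt k i x), zero_add]

lemma quad_add_mul_mod (k i x : ℕ) : (P.quad k i x + P.mu * x) % P.mu = P.quad k i x := by
  rw [Nat.add_mul_mod_self_left, Nat.mod_eq_of_lt (P.quad_lt k i x)]

lemma mem_L {k i y : ℕ} : y ∈ P.L k i ↔ y / P.mu < P.mu ∧ y % P.mu = P.quad k i (y / P.mu) := by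
  simp only [L, Finset.mem_image, Finset.mem_range]
  constructor
  · rintro ⟨x, hx, rfl⟩
    rw [mul_comm x, quad_add_mul_div, quad_add_mul_mod]
    exact ⟨hx, rfl⟩
  · rintro ⟨h1, h2⟩
    exact ⟨y / P.mu, h1, by rw [← h2, Nat.mod_add_div']⟩

lemma quad_mem_L {k i x : ℕ} (hx : x < P.mu) : P.quad k i x + P.mu * x ∈ P.L k i := by
  rw [mem_L, quad_add_mul_div, quad_add_mul_mod]
  exact ⟨hx, rfl⟩

/-- `L_i` depends on the color of the vertex only through its second coordinate. -/
lemma L_congr {k k' : ℕ} (h : P.b k = P.b k') (i : ℕ) : P.L k i = P.L k' i := by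
  simp only [L, quad, h]

lemma disjoint_L (k : ℕ) {i j : ℕ} (hi : i < P.mu) (hj : j < P.mu) (hij : i ≠ j) :
    Disjoint (P.L k i) (P.L k j) := by
  rw [Finset.disjoint_left]
  intro y hyi hyj
  rw [mem_L] at hyi hyj
  have h : _ ≡ _ [MOD P.mu] := hyi.2.symm.trans hyj.2
  have := Nat.ModEq.add_left_cancel' _ h
  rw [Nat.ModEq, Nat.mod_eq_of_lt hi, Nat.mod_eq_of_lt hj] at this
  exact hij this

/-- The sets `L_i`, `i ∈ [μ]`, are disjoint, so one that minimizes the intersection with a set `O`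
contains at most the fraction `1/μ` of it. -/
lemma card_L_inter_le_div {k i m : ℕ} {O : Finset ℕ} (hO : O.card ≤ m)
    (hmin : ∀ j < P.mu, (P.L k i ∩ O).card ≤ (P.L k j ∩ O).card) :
    (P.L k i ∩ O).card ≤ m / P.mu := by
  rw [Nat.le_div_iff_mul_le P.mu_prime.pos]
  refine le_trans ?_ hO
  have h1 : (P.L k i ∩ O).card * P.mu ≤ ∑ j ∈ Finset.range P.mu, (P.L k j ∩ O).card := by
    have := Finset.card_nsmul_le_sum (Finset.range P.mu) (fun j => (P.L k j ∩ O).card)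
      (P.L k i ∩ O).card (fun j hj => hmin j (Finset.mem_range.1 hj))
    simpa [mul_comm] using this
  refine h1.trans ?_
  rw [← Finset.card_biUnion]
  · exact Finset.card_le_card (Finset.biUnion_subset.2 fun j _ => Finset.inter_subset_right)
  · intro i hi j hj hij
    exact (P.disjoint_L k (Finset.mem_range.1 hi) (Finset.mem_range.1 hj) hij).mono
      Finset.inter_subset_left Finset.inter_subset_left

/-- Two quadratic polynomials over `GF(μ)` that belong to different `b` values agree in at most two
points. -/
lemma card_quad_eq_le_two (hτ : P.tau ≤ P.mu) {k k' : ℕ} (hk : P.b k < P.tau ^ 2)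
    (hk' : P.b k' < P.tau ^ 2) (hb : P.b k ≠ P.b k') (i i' : ℕ) :
    ((Finset.range P.mu).filter (fun x => P.quad k i x = P.quad k' i' x)).card ≤ 2 := by
  have : Fact P.mu.Prime := ⟨P.mu_prime⟩
  have hdiv : ∀ {m}, m < P.tau ^ 2 → m / P.tau < P.mu := fun h =>
    (Nat.div_lt_of_lt_mul (by rwa [← sq])).trans_le hτ
  have hmod : ∀ m, m % P.tau < P.mu := fun m => (Nat.mod_lt _ P.tau_prime.pos).trans_le hτ
  set α : ZMod P.mu := (P.b k / P.tau : ℕ) - (P.b k' / P.tau : ℕ) with hα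
  set β : ZMod P.mu := (P.b k % P.tau : ℕ) - (P.b k' % P.tau : ℕ) with hβ
  set p : Polynomial (ZMod P.mu) := Polynomial.C α * Polynomial.X ^ 2 +
    Polynomial.C β * Polynomial.X + Polynomial.C ((i : ZMod P.mu) - i') with hp
  have hp0 : p ≠ 0 := by
    intro h
    have hα0 : α = 0 := by
      have := congrArg (Polynomial.coeff · 2) h
      simpa [hp, Polynomial.coeff_X, Polynomial.coeff_C] using this
    have hβ0 : β = 0 := by
      have := congrArg (Polynomial.coeff · 1) h
      simpa [hp, Polynomial.coeff_X, Polynomial.coeff_C] using this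
    rw [hα, sub_eq_zero, ZMod.natCast_eq_natCast_iff', Nat.mod_eq_of_lt (hdiv hk),
      Nat.mod_eq_of_lt (hdiv hk')] at hα0
    rw [hβ, sub_eq_zero, ZMod.natCast_eq_natCast_iff', Nat.mod_eq_of_lt (hmod _),
      Nat.mod_eq_of_lt (hmod _)] at hβ0
    exact hb (by rw [← Nat.div_add_mod (P.b k) P.tau, hα0, hβ0, Nat.div_add_mod])
  have hmaps : ∀ x ∈ (Finset.range P.mu).filter (fun x => P.quad k i x = P.quad k' i' x),
      (x : ZMod P.mu) ∈ p.roots.toFinset := by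
    intro x hx
    have h := (Finset.mem_filter.1 hx).2
    rw [quad, quad, ← ZMod.natCast_eq_natCast_iff'] at h
    rw [Multiset.mem_toFinset, Polynomial.mem_roots hp0, Polynomial.IsRoot, hp]
    simp only [Polynomial.eval_add, Polynomial.eval_mul, Polynomial.eval_C, Polynomial.eval_pow,
      Polynomial.eval_X]
    push_cast at h
    rw [hα, hβ]
    linear_combination h
  refine (Finset.card_le_card_of_injOn _ hmaps ?_).trans ?_
  · intro x hx y hy hxy
    have hx' := Finset.mem_range.1 (Finset.mem_filter.1 hx).1
    have hy' := Finset.mem_range.1 (Finset.mem_filter.1 hy).1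
    have := (ZMod.natCast_eq_natCast_iff' _ _ _).1 hxy
    rwa [Nat.mod_eq_of_lt hx', Nat.mod_eq_of_lt hy'] at this
  · exact (Multiset.toFinset_card_le _).trans ((Polynomial.card_roots' _).trans
      Polynomial.natDegree_quadratic_le)

end Params

namespace Params

/-! ### Neighborhoods -/

variable {Δ N : ℕ} {P : Params Δ N} {V : Type*} [Fintype V] {G : SimpleGraph V}
  [DecidableRel G.Adj] {φ φ' ψ : V → ℕ} {u v : V} {n : ℕ}

lemma mem_nbrs2 : u ∈ P.nbrs2 G φ v ↔ G.Adj v u ∧ φ u ∈ P.I2 := by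
  rw [nbrs2, Finset.mem_filter, SimpleGraph.mem_neighborFinset]

lemma mem_M : u ∈ P.M G φ v ↔ (G.Adj v u ∧ φ u ∈ P.I2) ∧ P.aHat (φ u) ≠ P.aHat (φ v) ∧
    P.aTilde (φ u) = P.aTilde (φ v) := by
  rw [M, Finset.mem_filter, mem_nbrs2]

lemma mem_M' : u ∈ P.M' G φ v ↔ (G.Adj v u ∧ φ u ∈ P.I2) ∧ P.aHat (φ u) = 0 ∧
    P.aTilde (φ u) = P.aTilde (φ v) := by
  rw [M', Finset.mem_filter, mem_nbrs2]

lemma mem_Mbar' : u ∈ P.Mbar' G φ v ↔ (G.Adj v u ∧ φ u ∈ P.I2) ∧ P.aHat (φ u) ≠ 0 ∧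
    P.aTilde (φ u) = P.aTilde (φ v) := by
  rw [Mbar', Finset.mem_filter, mem_nbrs2]

lemma mem_A : u ∈ P.A G φ v ↔ (G.Adj v u ∧ φ u ∈ P.I2) ∧ P.a (φ u) = P.a (φ v) ∧
    P.c (φ u) ≤ P.c (φ v) := by
  rw [A, Finset.mem_filter, mem_nbrs2]

lemma mem_nbrsIn {x : ℕ} : u ∈ P.nbrsIn G φ v x ↔ G.Adj v u ∧ φ u ∈ P.I1 ∧
    x ∈ P.Fa (P.idx (φ u)) := by
  rw [nbrsIn, Finset.mem_filter, SimpleGraph.mem_neighborFinset]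

lemma mem_occupied {y : ℕ} : y ∈ P.occupied G φ v ↔ ∃ u, (G.Adj v u ∧ φ u ∈ P.I3) ∧ φ u = y := by
  simp only [occupied, Finset.mem_image, Finset.mem_filter, SimpleGraph.mem_neighborFinset]

lemma card_occupied_le (hdeg : G.degree v ≤ Δ) : (P.occupied G φ v).card ≤ Δ :=
  Finset.card_image_le.trans ((Finset.card_filter_le _ _).trans
    ((G.card_neighborFinset_eq_degree v).le.trans hdeg))

/-! ### Transition-in -/

lemma idx_lt {k : ℕ} (hk : k ∈ P.I1) : P.idx k < N := by
  rw [I1, Finset.mem_Ico] at hk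
  rw [idx]
  omega

lemma idx_ne {k k' : ℕ} (hk : k ∈ P.I1) (hk' : k' ∈ P.I1) (h : k ≠ k') : P.idx k ≠ P.idx k' := by
  rw [I1, Finset.mem_Ico] at hk hk'
  rw [idx, idx]
  omega

lemma exists_transitionIn (hN : 2 ≤ N) (hdeg : G.degree v ≤ Δ) (hφ : Proper G φ)
    (hmem : ∀ v, φ v ∈ P.I1) : ∃ k, P.TransitionIn G φ v k := by
  -- `N ≥ 2` provides a member of the families other than that of `v`, used as a filler when `v`
  -- has fewer than `Δ` neighbors.
  obtain ⟨p, hp, hpv⟩ : ∃ p < N, p ≠ P.idx (φ v) := by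
    by_cases h : P.idx (φ v) = 0
    · exact ⟨1, by omega, by omega⟩
    · exact ⟨0, by omega, fun h' => h h'.symm⟩
  have hne : ∀ u, G.Adj v u → P.idx (φ u) < N ∧ P.idx (φ u) ≠ P.idx (φ v) := fun u hu =>
    ⟨idx_lt (hmem u), idx_ne (hmem u) (hmem v) (hφ v u hu).symm⟩
  have ha : {x | x ∈ P.Fa (P.idx (φ v)) ∧ (P.nbrsIn G φ v x).card ≤ rho Δ}.Nonempty := by
    obtain ⟨f, hf, hcard⟩ := exists_padding (G.neighborFinset v) (d := Δ)
      ((G.card_neighborFinset_eq_degree v).le.trans hdeg) (fun u => P.idx (φ u)) p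
    obtain ⟨x, hx, hxc⟩ := P.Fa_coverFree _ (idx_lt (hmem v)) f (fun j => by
      rcases hf j with h | ⟨u, hu, h⟩
      · rw [h]; exact ⟨hp, hpv⟩
      · rw [h]; exact hne u ((G.mem_neighborFinset v u).1 hu))
    refine ⟨x, hx, le_trans ?_ ((hcard (fun i => x ∈ P.Fa i)).trans hxc)⟩
    refine Finset.card_le_card fun u hu => ?_
    rw [mem_nbrsIn] at hu
    exact Finset.mem_filter.2 ⟨(G.mem_neighborFinset v u).2 hu.1, hu.2.2⟩
  obtain ⟨a, ha⟩ := exists_isLeast ha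
  have hb : {y | y ∈ P.Fb (P.idx (φ v)) ∧
      ∀ u ∈ P.nbrsIn G φ v a, y ∉ P.Fb (P.idx (φ u))}.Nonempty := by
    obtain ⟨f, hf, hcard⟩ := exists_padding (P.nbrsIn G φ v a) ha.1.2 (fun u => P.idx (φ u)) p
    obtain ⟨y, hy, hyf⟩ := P.Fb_coverFree _ (idx_lt (hmem v)) f (fun j => by
      rcases hf j with h | ⟨u, hu, h⟩
      · rw [h]; exact ⟨hp, hpv⟩
      · rw [h]; exact hne u (mem_nbrsIn.1 hu).1)
    refine ⟨y, hy, fun u hu hyu => ?_⟩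
    have h1 := hcard (fun i => y ∈ P.Fb i)
    have h2 : (Finset.univ.filter (fun j => y ∈ P.Fb (f j))) = ∅ :=
      Finset.filter_eq_empty_iff.2 fun j _ => hyf j
    rw [h2, Finset.card_empty, Nat.le_zero, Finset.card_eq_zero] at h1
    exact Finset.notMem_empty u (h1 ▸ Finset.mem_filter.2 ⟨hu, hyu⟩)
  obtain ⟨b, hb⟩ := exists_isLeast hb
  exact ⟨_, a, b, ha, hb, rfl⟩

variable (P G) in
/-- The situation right after the transition-in round: the `a` values are a `Δ^{1/4}`-defective
coloring, whose defects are resolved by the `b` values. -/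
structure Start (ψ : V → ℕ) : Prop where
  mem : ∀ v, ψ v ∈ P.I2
  b_lt : ∀ v, P.b (ψ v) < m2 Δ N
  c_eq : ∀ v, P.c (ψ v) = 0
  d_eq : ∀ v, P.d (ψ v) = P.mu
  defect : ∀ v, ((G.neighborFinset v).filter (fun u => P.a (ψ u) = P.a (ψ v))).card ≤ rho Δ
  b_ne : ∀ u v, G.Adj u v → P.a (ψ u) = P.a (ψ v) → P.b (ψ u) ≠ P.b (ψ v)

lemma Start.of_transitionIn (hΔ : 1 ≤ Δ) (hN : 2 ≤ N) (hN' : N ≤ 4 * (Δ + 1) ^ 2)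
    (hmem : ∀ v, φ v ∈ P.I1) (h : ∀ v, P.TransitionIn G φ v (ψ v)) : P.Start G ψ := by
  choose a b ha hb hψ using h
  have hlt := P.lam_prime.one_lt
  have hb_lt : ∀ v, b v < m2 Δ N := fun v =>
    Finset.mem_range.1 (P.Fb_system.1 _ (idx_lt (hmem v)) (hb v).1.1)
  have hspec : ∀ v, _ := fun v => P.encode_spec (a := a v) (b := b v) (c := 0) (d := P.mu)
    ((Finset.mem_range.1 (P.Fa_system.1 _ (idx_lt (hmem v)) (ha v).1.1)).trans P.m1_lt_sq)
    ((hb_lt v).trans_le ((P.m2_le_tau_sq hΔ hN hN').trans (P.tau_sq_le_m3 hΔ hN)))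
    (by omega) (by omega)
  simp only [← hψ] at hspec
  -- A neighbor with the same new `a` belongs to `N'(v, a)`.
  have hin : ∀ v u, G.Adj v u → P.a (ψ u) = P.a (ψ v) → u ∈ P.nbrsIn G φ v (a v) := by
    intro v u huv h
    rw [(hspec u).2.1, (hspec v).2.1] at h
    exact mem_nbrsIn.2 ⟨huv, hmem u, h ▸ (ha u).1.1⟩
  refine ⟨fun v => (hspec v).1, fun v => ?_, fun v => (hspec v).2.2.2.1,
    fun v => (hspec v).2.2.2.2, fun v => ?_, fun u v huv h => ?_⟩
  · rw [(hspec v).2.2.1]; exact hb_lt v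
  · refine (Finset.card_le_card fun u hu => ?_).trans (ha v).1.2
    rw [Finset.mem_filter, SimpleGraph.mem_neighborFinset] at hu
    exact hin v u hu.1 hu.2
  · rw [(hspec u).2.2.1, (hspec v).2.2.1]
    intro hbb
    exact (hb u).1.2 v (hin u v huv h.symm) (hbb ▸ (hb v).1.1)

/-! ### The invariant of the later rounds -/

variable (P G) in
/-- The state `φ` of an execution that was in the situation `ψ` right after transition-in, `n` rounds
earlier. The vertices in the core stage still carry their initial `b` value and have moved along the
line `ã + n â`; on `I₂` the pairs `(a, b)` form a proper coloring; and for a vertex that has fixed a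
quadratic polynomial, the colors of `L_i` taken by neighbors together with the neighbors that may
still take one of them are few. -/
structure Inv (ψ : V → ℕ) (n : ℕ) (φ : V → ℕ) : Prop where
  mem : ∀ v, φ v ∈ P.I2 ∨ φ v ∈ P.I3
  core : ∀ v, φ v ∈ P.I2 → P.lam ≤ P.a (φ v) → P.aHat (φ v) = P.aHat (ψ v) ∧
    P.aTilde (φ v) = (P.aTilde (ψ v) + n * P.aHat (ψ v)) % P.lam ∧ P.b (φ v) = P.b (ψ v) ∧
    P.d (φ v) = P.mu
  b_lt : ∀ v, φ v ∈ P.I2 → P.b (φ v) < P.tau ^ 2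
  c_le : ∀ v, φ v ∈ P.I2 → P.c (φ v) ≤ n
  b_ne : ∀ u v, G.Adj u v → φ u ∈ P.I2 → φ v ∈ P.I2 → P.a (φ u) = P.a (φ v) →
    P.b (φ u) ≠ P.b (φ v)
  ne_of_mem_I3 : ∀ u v, G.Adj u v → φ u ∈ P.I3 → φ v ∈ P.I3 → φ u ≠ φ v
  card_A : ∀ v, φ v ∈ P.I2 → (P.A G φ v).card ≤ 2 * rho Δ
  ready : ∀ v, φ v ∈ P.I2 → P.a (φ v) < P.lam → P.d (φ v) ≠ P.mu → P.OutReady G φ v ∧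
    (P.L (φ v) (P.d (φ v)) ∩ P.occupied G φ v).card + (P.A G φ v).card ≤ Δ / P.mu + 2 * rho Δ

lemma Start.inv (hΔ : 1 ≤ Δ) (hN : 2 ≤ N) (hN' : N ≤ 4 * (Δ + 1) ^ 2) (h : P.Start G ψ) :
    P.Inv G ψ 0 ψ where
  mem v := Or.inl (h.mem v)
  core v _ _ := ⟨rfl, by rw [Nat.zero_mul, add_zero, Nat.mod_eq_of_lt (P.aTilde_lt _)], rfl,
    h.d_eq v⟩
  b_lt v _ := (h.b_lt v).trans_le (P.m2_le_tau_sq hΔ hN hN')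
  c_le v _ := (h.c_eq v).le
  b_ne u v huv _ _ hab := h.b_ne u v huv hab
  ne_of_mem_I3 u v _ hu := absurd hu (P.not_mem_I3_of_mem_I2 (h.mem u))
  card_A v _ := by
    have h1 : P.A G ψ v ⊆ (G.neighborFinset v).filter (fun u => P.a (ψ u) = P.a (ψ v)) := by
      intro u hu
      rw [mem_A] at hu
      exact Finset.mem_filter.2 ⟨(G.mem_neighborFinset v u).2 hu.1.1, hu.2.1⟩
    have := (Finset.card_le_card h1).trans (h.defect v)
    omega
  ready v _ _ hd := absurd (h.d_eq v) hd

lemma Inv.proper (h : P.Inv G ψ n φ) : Proper G φ := by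
  intro u v huv heq
  rcases h.mem u with hu | hu
  · exact h.b_ne u v huv hu (heq ▸ hu) (by rw [heq]) (by rw [heq])
  · exact h.ne_of_mem_I3 u v huv hu (heq ▸ hu) heq

/-- Points that move along the lines `ã + n â` coincide after `n` rounds exactly if they coincided
initially. -/
lemma a_eq_iff_of_line {k l k₀ l₀ : ℕ}
    (hk : P.aHat k = P.aHat k₀) (hk' : P.aTilde k = (P.aTilde k₀ + n * P.aHat k₀) % P.lam)
    (hl : P.aHat l = P.aHat l₀) (hl' : P.aTilde l = (P.aTilde l₀ + n * P.aHat l₀) % P.lam) :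
    P.a k = P.a l ↔ P.a k₀ = P.a l₀ := by
  constructor
  · intro h
    have h1 : P.aHat k₀ = P.aHat l₀ := by rw [← hk, ← hl, aHat, h, aHat]
    have h2 : P.aTilde k = P.aTilde l := by rw [aTilde, h, aTilde]
    rw [hk', hl', h1] at h2
    have h3 := Nat.ModEq.add_right_cancel' _ h2
    rw [Nat.ModEq, Nat.mod_eq_of_lt (P.aTilde_lt _), Nat.mod_eq_of_lt (P.aTilde_lt _)] at h3
    rw [← P.aHat_mul_add_aTilde, ← P.aHat_mul_add_aTilde l₀, h1, h3]
  · intro h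
    rw [← P.aHat_mul_add_aTilde, ← P.aHat_mul_add_aTilde l, hk, hk', hl, hl', aHat, aTilde, h,
      aHat, aTilde]

lemma Inv.a_start_eq (h : P.Inv G ψ n φ) (hu : φ u ∈ P.I2) (hv : φ v ∈ P.I2)
    (hcore : P.lam ≤ P.a (φ v)) (ha : P.a (φ u) = P.a (φ v)) : P.a (ψ u) = P.a (ψ v) := by
  obtain ⟨h1, h2, -⟩ := h.core v hv hcore
  obtain ⟨h1', h2', -⟩ := h.core u hu (ha ▸ hcore)
  exact (a_eq_iff_of_line h1' h2' h1 h2).1 ha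

lemma Inv.card_same_a_le (hS : P.Start G ψ) (h : P.Inv G ψ n φ) (hv : φ v ∈ P.I2)
    (hcore : P.lam ≤ P.a (φ v)) :
    ((P.nbrs2 G φ v).filter (fun u => P.a (φ u) = P.a (φ v))).card ≤ rho Δ := by
  refine (Finset.card_le_card fun u hu => ?_).trans (hS.defect v)
  rw [Finset.mem_filter, mem_nbrs2] at hu
  exact Finset.mem_filter.2 ⟨(G.mem_neighborFinset v u).2 hu.1.1,
    h.a_start_eq hu.1.2 hv hcore hu.2⟩

/-- If few neighbors are in conflict, then few have the same `ã` at all. -/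
lemma Inv.card_same_aTilde_le (hS : P.Start G ψ) (h : P.Inv G ψ n φ) (hv : φ v ∈ P.I2)
    (hcore : P.lam ≤ P.a (φ v)) (hM : (P.M G φ v).card ≤ rho Δ) :
    ((P.nbrs2 G φ v).filter (fun u => P.aTilde (φ u) = P.aTilde (φ v))).card ≤ 2 * rho Δ := by
  classical
  have h1 : (P.nbrs2 G φ v).filter (fun u => P.aTilde (φ u) = P.aTilde (φ v)) ⊆
      P.M G φ v ∪ (P.nbrs2 G φ v).filter (fun u => P.a (φ u) = P.a (φ v)) := by
    intro u hu
    rw [Finset.mem_filter] at hu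
    rw [Finset.mem_union, mem_M, Finset.mem_filter]
    by_cases he : P.aHat (φ u) = P.aHat (φ v)
    · exact Or.inr ⟨hu.1, by rw [← P.aHat_mul_add_aTilde, ← P.aHat_mul_add_aTilde (φ v), he, hu.2]⟩
    · exact Or.inl ⟨mem_nbrs2.1 hu.1, he, hu.2⟩
  have h2 := h.card_same_a_le hS hv hcore
  have h3 := (Finset.card_le_card h1).trans (Finset.card_union_le _ _)
  omega

/-! ### No round gets stuck -/

lemma Inv.exists_core (hΔ : 1 ≤ Δ) (hN : 2 ≤ N) (hS : P.Start G ψ)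
    (h : P.Inv G ψ n φ) (hv : φ v ∈ P.I2) (hcore : P.lam ≤ P.a (φ v)) :
    ∃ k, P.Core G φ v k := by
  classical
  by_cases hM : rho Δ < (P.M G φ v).card
  · exact ⟨_, fun h' => absurd h' (not_le.2 hM), fun _ => rfl⟩
  rw [not_lt] at hM
  have hb : ∀ u, φ u ∈ P.I2 → P.lam ≤ P.a (φ u) → P.b (φ u) < m2 Δ N := fun u hu hc => by
    rw [(h.core u hu hc).2.2.1]; exact hS.b_lt u
  set s := (P.nbrs2 G φ v).filter (fun u => P.aTilde (φ u) = P.aTilde (φ v)) with hs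
  -- A settled neighbor excludes one element, another one the intersection of two members of `F_c`.
  obtain ⟨y, hy, hyb⟩ := exists_mem_forall_not_mem (S := P.Sc (P.scIdx (φ v))) (s := s)
    (bad := fun u => if P.aHat (φ u) = 0 then {P.b (φ u)} else P.Sc (P.scIdx (φ u)))
    (D := Nat.log 2 (P.lam ^ 2 * m2 Δ N)) (by
      intro u hu
      rw [hs, Finset.mem_filter, mem_nbrs2] at hu
      split_ifs with h0
      · exact (Finset.card_le_card Finset.inter_subset_right).trans
          ((Finset.card_singleton _).le.trans (P.one_le_log hΔ hN))
      · rw [aHat_eq_zero_iff, not_lt] at h0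
        have hbu := hb u hu.1.2 h0
        refine P.card_Sc_inter_le (P.scIdx_lt hv (hb v hv hcore)) (P.scIdx_lt hu.1.2 hbu)
          fun he => ?_
        obtain ⟨h1, h2⟩ := P.a_eq_and_b_eq_of_scIdx_eq (hb v hv hcore) hbu he
        exact h.b_ne v u hu.1.1 hv hu.1.2 h1 h2) (by
      rw [card_Sc]
      exact lt_of_le_of_lt (Nat.mul_le_mul_right _ (h.card_same_aTilde_le hS hv hcore hM))
        (P.two_rho_mul_log_lt_tau hΔ hN))
  obtain ⟨b, hb⟩ := exists_isLeast (s := {y | y ∈ P.Sc (P.scIdx (φ v)) ∧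
      (∀ u ∈ P.M' G φ v, y ≠ P.b (φ u)) ∧ ∀ u ∈ P.Mbar' G φ v, y ∉ P.Sc (P.scIdx (φ u))})
    ⟨y, hy, fun u hu => by
      rw [mem_M'] at hu
      have := hyb u (by rw [hs, Finset.mem_filter, mem_nbrs2]; exact ⟨hu.1, hu.2.2⟩)
      rwa [if_pos hu.2.1, Finset.mem_singleton] at this, fun u hu => by
      rw [mem_Mbar'] at hu
      have := hyb u (by rw [hs, Finset.mem_filter, mem_nbrs2]; exact ⟨hu.1, hu.2.2⟩)
      rwa [if_neg hu.2.1] at this⟩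
  exact ⟨_, fun _ => ⟨b, hb, rfl⟩, fun h' => absurd hM (not_le.2 h')⟩

lemma exists_outPrepare : ∃ k, P.OutPrepare G φ v k := by
  obtain ⟨i, hi, hmin⟩ := Finset.exists_min_image (Finset.range P.mu)
    (fun i => (P.L (φ v) i ∩ P.occupied G φ v).card) ⟨0, Finset.mem_range.2 P.mu_prime.pos⟩
  exact ⟨_, i, Finset.mem_range.1 hi, fun j hj => hmin j (Finset.mem_range.2 hj), rfl⟩

/-- The parameters `x` excluded for the last step of transition-out number at most
`Δ/μ + 4Δ^{1/4}`: a neighbor in `A(v)` excludes at most two, as two quadratic polynomials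
agree in at most two points. -/
lemma Inv.exists_le_outMove (hΔ : 1 ≤ Δ) (hN : 2 ≤ N) (h : P.Inv G ψ n φ) (hv : φ v ∈ P.I2)
    (ha : P.a (φ v) < P.lam) (hd : P.d (φ v) ≠ P.mu) :
    ∃ y ≤ Δ / P.mu + 4 * rho Δ, y < P.mu ∧
      P.quad (φ v) (P.d (φ v)) y + P.mu * y ∈ P.L (φ v) (P.d (φ v)) ∧
      P.quad (φ v) (P.d (φ v)) y + P.mu * y ∉ P.occupied G φ v ∧
      ∀ u ∈ P.A G φ v, P.quad (φ v) (P.d (φ v)) y + P.mu * y ∉ P.L (φ u) (P.d (φ u)) := by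
  classical
  have hmu := P.div_add_lt_mu hΔ hN
  have hready := (h.ready v hv ha hd).2
  have hA := h.card_A v hv
  set f : ℕ → ℕ := fun y => P.quad (φ v) (P.d (φ v)) y + P.mu * y with hf
  have hfinj : Function.Injective f := fun x y hxy => by
    have := congrArg (· / P.mu) hxy
    simpa only [hf, quad_add_mul_div] using this
  set bad1 := (Finset.range P.mu).filter (fun y => f y ∈ P.occupied G φ v)
  set bad2 := (P.A G φ v).biUnion (fun u => (Finset.range P.mu).filter
    (fun y => P.quad (φ v) (P.d (φ v)) y = P.quad (φ u) (P.d (φ u)) y))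
  have h1 : bad1.card ≤ (P.L (φ v) (P.d (φ v)) ∩ P.occupied G φ v).card := by
    refine Finset.card_le_card_of_injOn f (fun y hy => ?_) hfinj.injOn
    have hy' := Finset.mem_filter.1 hy
    exact Finset.mem_inter.2 ⟨P.quad_mem_L (Finset.mem_range.1 hy'.1), hy'.2⟩
  have h2 : bad2.card ≤ (P.A G φ v).card * 2 := by
    refine Finset.card_biUnion_le_card_mul _ _ _ fun u hu => ?_
    rw [mem_A] at hu
    exact P.card_quad_eq_le_two (P.tau_le_mu hΔ hN) (h.b_lt v hv) (h.b_lt u hu.1.2)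
      (h.b_ne v u hu.1.1 hv hu.1.2 hu.2.1.symm) _ _
  have h3 : (bad1 ∪ bad2).card < (Finset.range (Δ / P.mu + 4 * rho Δ + 1)).card := by
    rw [Finset.card_range]
    have := Finset.card_union_le bad1 bad2
    omega
  obtain ⟨y, hy, hy'⟩ := Finset.exists_mem_notMem_of_card_lt_card h3
  rw [Finset.mem_range] at hy
  rw [Finset.mem_union, not_or] at hy'
  have hymu : y < P.mu := by omega
  refine ⟨y, by omega, hymu, P.quad_mem_L hymu, fun ho => hy'.1 ?_, fun u hu hL => hy'.2 ?_⟩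
  · exact Finset.mem_filter.2 ⟨Finset.mem_range.2 hymu, ho⟩
  · rw [mem_L, quad_add_mul_div, quad_add_mul_mod] at hL
    exact Finset.mem_biUnion.2 ⟨u, hu, Finset.mem_filter.2 ⟨Finset.mem_range.2 hymu, hL.2⟩⟩

lemma Inv.exists_transitionOut (hΔ : 1 ≤ Δ) (hN : 2 ≤ N) (h : P.Inv G ψ n φ)
    (hv : φ v ∈ P.I2) (ha : P.a (φ v) < P.lam) : ∃ k, P.TransitionOut G φ v k := by
  by_cases h0 : P.OutReady G φ v
  · by_cases hd : P.d (φ v) = P.mu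
    · obtain ⟨k, hk⟩ := exists_outPrepare (P := P) (G := G) (φ := φ) (v := v)
      exact ⟨k, fun _ => hk, fun h' => absurd hd h'.2.1,
        fun h' => (h'.elim (absurd h0) fun h' => absurd hd h'.1)⟩
    · by_cases hA : ∀ u ∈ P.A G φ v, P.d (φ u) ≠ P.mu
      · obtain ⟨y, -, hy⟩ := h.exists_le_outMove hΔ hN hv ha hd
        obtain ⟨x, hx⟩ := exists_isLeast (s := {y | y < P.mu ∧
          P.quad (φ v) (P.d (φ v)) y + P.mu * y ∈ P.L (φ v) (P.d (φ v)) ∧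
          P.quad (φ v) (P.d (φ v)) y + P.mu * y ∉ P.occupied G φ v ∧
          ∀ u ∈ P.A G φ v, P.quad (φ v) (P.d (φ v)) y + P.mu * y ∉ P.L (φ u) (P.d (φ u))}) ⟨y, hy⟩
        refine ⟨_, fun h' => absurd h'.2 hd, fun _ => ⟨x, hx, rfl⟩, fun h' => ?_⟩
        rcases h' with h' | ⟨-, u, hu, h'⟩
        · exact absurd h0 h'
        · exact absurd h' (hA u hu)
      · exact ⟨φ v, fun h' => absurd h'.2 hd, fun h' => absurd h'.2.2 hA, fun _ => rfl⟩
  · exact ⟨φ v, fun h' => absurd h'.1 h0, fun h' => absurd h'.1 h0, fun _ => rfl⟩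

lemma exists_standard (hdeg : G.degree v ≤ Δ) : ∃ k, P.Standard G φ v k := by
  by_cases h : ∀ u, G.Adj v u → φ u ∈ P.I3 ∧ φ u < φ v
  · have hc : ((G.neighborFinset v).image φ).card < (Finset.range (Δ + 1)).card := by
      rw [Finset.card_range, Nat.lt_succ_iff]
      exact Finset.card_image_le.trans ((G.card_neighborFinset_eq_degree v).le.trans hdeg)
    obtain ⟨x, hx, hx'⟩ := Finset.exists_mem_notMem_of_card_lt_card hc
    obtain ⟨k, hk⟩ := exists_isLeast (s := {x | x < Δ + 1 ∧ ∀ u, G.Adj v u → x ≠ φ u})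
      ⟨x, Finset.mem_range.1 hx, fun u hu he => hx' (Finset.mem_image.2
        ⟨u, (G.mem_neighborFinset v u).2 hu, he.symm⟩)⟩
    exact ⟨k, fun _ => hk, fun h' => absurd h h'⟩
  · exact ⟨φ v, fun h' => absurd h' h, fun _ => rfl⟩

lemma Inv.exists_round (hΔ : 1 ≤ Δ) (hN : 2 ≤ N) (hdeg : ∀ v, G.degree v ≤ Δ)
    (hS : P.Start G ψ) (h : P.Inv G ψ n φ) : ∃ φ', P.Round G φ φ' := by
  have key : ∀ v, ∃ k, (φ v ∈ P.I1 → P.TransitionIn G φ v k) ∧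
      (φ v ∈ P.I2 → P.lam ≤ P.a (φ v) → P.Core G φ v k) ∧
      (φ v ∈ P.I2 → P.a (φ v) < P.lam → P.TransitionOut G φ v k) ∧
      (φ v ∈ P.I3 → P.Standard G φ v k) := by
    intro v
    rcases h.mem v with hv | hv
    · have h1 := P.not_mem_I1_of_mem_I2 hv
      have h3 := P.not_mem_I3_of_mem_I2 hv
      rcases le_or_gt P.lam (P.a (φ v)) with ha | ha
      · obtain ⟨k, hk⟩ := h.exists_core hΔ hN hS hv ha
        exact ⟨k, fun h' => absurd h' h1, fun _ _ => hk, fun _ h' => absurd ha (not_le.2 h'),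
          fun h' => absurd h' h3⟩
      · obtain ⟨k, hk⟩ := h.exists_transitionOut hΔ hN hv ha
        exact ⟨k, fun h' => absurd h' h1, fun _ h' => absurd ha (not_lt.2 h'), fun _ _ => hk,
          fun h' => absurd h' h3⟩
    · have h1 := P.not_mem_I1_of_mem_I3 hv
      have h2 : φ v ∉ P.I2 := fun h' => P.not_mem_I3_of_mem_I2 h' hv
      obtain ⟨k, hk⟩ := exists_standard (P := P) (φ := φ) (hdeg v)
      exact ⟨k, fun h' => absurd h' h1, fun h' => absurd h' h2, fun h' => absurd h' h2,
        fun _ => hk⟩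
  choose φ' hφ' using key
  exact ⟨φ', hφ'⟩

/-! ### The effect of one round -/

variable (P G φ φ' v) in
/-- The ways in which the color of `v` can change in a round from `φ` to `φ'` after transition-in,
with the new color described by its coordinates. -/
inductive Outcome : Prop
  /-- A core vertex with too many conflicts moves on. -/
  | advance (hv : φ v ∈ P.I2) (ha : P.lam ≤ P.a (φ v)) (hM : rho Δ < (P.M G φ v).card)
      (hv' : φ' v ∈ P.I2) (hhat : P.aHat (φ' v) = P.aHat (φ v))
      (htilde : P.aTilde (φ' v) = (P.aHat (φ v) + P.aTilde (φ v)) % P.lam)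
      (hb : P.b (φ' v) = P.b (φ v)) (hc : P.c (φ' v) = P.c (φ v)) (hd : P.d (φ' v) = P.d (φ v))
  /-- A core vertex with few conflicts settles at an `a` value below `λ`. -/
  | settle (hv : φ v ∈ P.I2) (ha : P.lam ≤ P.a (φ v)) (hM : (P.M G φ v).card ≤ rho Δ)
      (hv' : φ' v ∈ P.I2) (ha' : P.a (φ' v) = P.aTilde (φ v))
      (hb : P.b (φ' v) ∈ P.Sc (P.scIdx (φ v)))
      (hb1 : ∀ u ∈ P.M' G φ v, P.b (φ' v) ≠ P.b (φ u))
      (hb2 : ∀ u ∈ P.Mbar' G φ v, P.b (φ' v) ∉ P.Sc (P.scIdx (φ u)))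
      (hc : P.c (φ' v) = 1 + (P.M' G φ v).sup (fun u => P.c (φ u)))
      (hd : P.d (φ' v) = P.d (φ v))
  /-- A settled vertex has to wait. -/
  | wait (hv : φ v ∈ P.I2) (ha : P.a (φ v) < P.lam) (he : φ' v = φ v)
      (hn : ¬ P.OutReady G φ v ∨ P.d (φ v) ≠ P.mu ∧ ∃ u ∈ P.A G φ v, P.d (φ u) = P.mu)
  /-- A settled vertex fixes its quadratic polynomial. -/
  | prepare (hv : φ v ∈ P.I2) (ha : P.a (φ v) < P.lam) (h0 : P.OutReady G φ v)
      (hd : P.d (φ v) = P.mu) (hv' : φ' v ∈ P.I2) (ha' : P.a (φ' v) = P.a (φ v))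
      (hb' : P.b (φ' v) = P.b (φ v)) (hc' : P.c (φ' v) = P.c (φ v)) (hd' : P.d (φ' v) < P.mu)
      (hmin : (P.L (φ v) (P.d (φ' v)) ∩ P.occupied G φ v).card ≤ Δ / P.mu)
  /-- A settled vertex moves to `I₃`. -/
  | move (hv : φ v ∈ P.I2) (ha : P.a (φ v) < P.lam) (h0 : P.OutReady G φ v)
      (hd : P.d (φ v) ≠ P.mu) (hA : ∀ u ∈ P.A G φ v, P.d (φ u) ≠ P.mu)
      (hv' : φ' v ∈ P.I3) (hL : φ' v ∈ P.L (φ v) (P.d (φ v))) (ho : φ' v ∉ P.occupied G φ v)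
      (hLA : ∀ u ∈ P.A G φ v, φ' v ∉ P.L (φ u) (P.d (φ u)))
  /-- A vertex in `I₃` takes part in the standard reduction. -/
  | reduce (hv : φ v ∈ P.I3) (hv' : φ' v ∈ P.I3)
      (h : φ' v = φ v ∨ (∀ u, G.Adj v u → φ u ∈ P.I3 ∧ φ u < φ v) ∧
        ∀ u, G.Adj v u → φ' v ≠ φ u)

lemma Inv.core_outcome (hΔ : 1 ≤ Δ) (hN : 2 ≤ N) (h : P.Inv G ψ n φ)
    (hn : n < P.lam) (hv : φ v ∈ P.I2) (hcore : P.lam ≤ P.a (φ v))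
    (hC : P.Core G φ v (φ' v)) : P.Outcome G φ φ' v := by
  have hτ := P.tau_sq_le_m3 hΔ hN
  have hhat := P.aHat_lt hv
  have hlam := P.lam_prime.pos
  rcases le_or_gt (P.M G φ v).card (rho Δ) with hM | hM
  · obtain ⟨b, hb, hk⟩ := hC.1 hM
    have hc : 1 + (P.M' G φ v).sup (fun u => P.c (φ u)) ≤ 1 + n := by
      refine Nat.add_le_add_left (Finset.sup_le fun u hu => h.c_le u (mem_M'.1 hu).1.2) 1
    obtain ⟨h1, h2, h3, h4, h5⟩ := P.encode_spec (a := P.aTilde (φ v)) (b := b)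
      (c := 1 + (P.M' G φ v).sup (fun u => P.c (φ u))) (d := P.d (φ v))
      ((P.aTilde_lt _).trans_le (Nat.le_self_pow two_ne_zero _))
      ((P.lt_of_mem_Sc hb.1.1).trans_le hτ) (by omega) (P.d_lt _)
    rw [← hk] at h1 h2 h3 h4 h5
    exact .settle hv hcore hM h1 h2 (h3 ▸ hb.1.1) (h3 ▸ hb.1.2.1) (h3 ▸ hb.1.2.2) h4 h5
  · have hk := hC.2 hM
    have ht := Nat.mod_lt (P.aHat (φ v) + P.aTilde (φ v)) hlam
    obtain ⟨h1, h2, h3, h4, h5⟩ := P.encode_spec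
      (a := P.aHat (φ v) * P.lam + (P.aHat (φ v) + P.aTilde (φ v)) % P.lam)
      (b := P.b (φ v)) (c := P.c (φ v)) (d := P.d (φ v)) (by nlinarith)
      ((h.b_lt v hv).trans_le hτ) (P.c_lt _) (P.d_lt _)
    rw [← hk] at h1 h2 h3 h4 h5
    refine .advance hv hcore hM h1 ?_ ?_ h3 h4 h5
    · rw [aHat, h2, mul_comm, Nat.mul_add_div hlam, Nat.div_eq_of_lt ht, add_zero]
    · rw [aTilde, h2, mul_comm, Nat.mul_add_mod, Nat.mod_mod]

lemma Inv.transitionOut_outcome (hΔ : 1 ≤ Δ) (hN : 2 ≤ N) (hdeg : G.degree v ≤ Δ)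
    (h : P.Inv G ψ n φ) (hv : φ v ∈ P.I2) (ha : P.a (φ v) < P.lam)
    (hT : P.TransitionOut G φ v (φ' v)) : P.Outcome G φ φ' v := by
  by_cases hwait : ¬ P.OutReady G φ v ∨ P.d (φ v) ≠ P.mu ∧ ∃ u ∈ P.A G φ v, P.d (φ u) = P.mu
  · exact .wait hv ha (hT.2.2 hwait) hwait
  have h0 : P.OutReady G φ v := by by_contra h0; exact hwait (Or.inl h0)
  by_cases hd : P.d (φ v) = P.mu
  · obtain ⟨i, hi, hmin, hk⟩ := hT.1 ⟨h0, hd⟩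
    obtain ⟨h1, h2, h3, h4, h5⟩ := P.encode_spec (d := i) (P.a_lt hv)
      ((h.b_lt v hv).trans_le (P.tau_sq_le_m3 hΔ hN)) (P.c_lt (φ v)) (by omega)
    rw [← hk] at h1 h2 h3 h4 h5
    exact .prepare hv ha h0 hd h1 h2 h3 h4 (h5 ▸ hi)
      (h5.symm ▸ P.card_L_inter_le_div (card_occupied_le hdeg) hmin)
  · have hA : ∀ u ∈ P.A G φ v, P.d (φ u) ≠ P.mu := fun u hu hdu =>
      hwait (Or.inr ⟨hd, u, hu, hdu⟩)
    obtain ⟨x, hx, hk⟩ := hT.2.1 ⟨h0, hd, hA⟩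
    obtain ⟨y, hyle, hy⟩ := h.exists_le_outMove hΔ hN hv ha hd
    have hxy : x ≤ y := hx.2 hy
    have hI3 : φ' v ∈ P.I3 := by
      rw [I3, Finset.mem_range, hk]
      refine lt_of_lt_of_le ?_ (P.mul_mu_le_ell3 hΔ hN)
      have h1 := P.quad_lt (φ v) (P.d (φ v)) x
      have h2 := Nat.mul_le_mul_left P.mu (hxy.trans hyle)
      rw [add_mul, one_mul, mul_comm _ P.mu]
      omega
    refine .move hv ha h0 hd hA hI3 ?_ ?_ ?_
    · rw [hk]; exact hx.1.2.1
    · rw [hk]; exact hx.1.2.2.1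
    · rw [hk]; exact hx.1.2.2.2

/-- The bound on `n` keeps the `c` values of core vertices below `2λ`. -/
lemma Inv.outcome (hΔ : 1 ≤ Δ) (hN : 2 ≤ N) (hdeg : ∀ v, G.degree v ≤ Δ)
    (h : P.Inv G ψ n φ) (hn : n < P.lam ∨ ∀ v, φ v ∈ P.I2 → P.a (φ v) < P.lam)
    (hR : P.Round G φ φ') (v : V) : P.Outcome G φ φ' v := by
  rcases h.mem v with hv | hv
  · rcases le_or_gt P.lam (P.a (φ v)) with ha | ha
    · rcases hn with hn | hn
      · exact h.core_outcome hΔ hN hn hv ha ((hR v).2.1 hv ha)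
      · exact absurd (hn v hv) (not_lt.2 ha)
    · exact h.transitionOut_outcome hΔ hN (hdeg v) hv ha ((hR v).2.2.1 hv ha)
  · have hS := (hR v).2.2.2 hv
    by_cases hc : ∀ u, G.Adj v u → φ u ∈ P.I3 ∧ φ u < φ v
    · have hk := (hS.1 hc).1
      have := P.lt_ell3 hΔ hN
      have hk1 : φ' v < Δ + 1 := hk.1
      exact .reduce hv (by rw [I3, Finset.mem_range]; omega) (Or.inr ⟨hc, hk.2⟩)
    · have hk := hS.2 hc
      exact .reduce hv (hk ▸ hv) (Or.inl hk)

namespace Outcome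

lemma mem (o : P.Outcome G φ φ' v) : φ' v ∈ P.I2 ∨ φ' v ∈ P.I3 := by
  cases o with
  | advance _ _ _ hv' => exact Or.inl hv'
  | settle _ _ _ hv' => exact Or.inl hv'
  | wait hv _ he => exact Or.inl (he ▸ hv)
  | prepare _ _ _ _ hv' => exact Or.inl hv'
  | move _ _ _ _ _ hv' => exact Or.inr hv'
  | reduce _ hv' => exact Or.inr hv'

lemma mem_I3 (o : P.Outcome G φ φ' v) (hv : φ v ∈ P.I3) : φ' v ∈ P.I3 := by
  cases o with
  | reduce _ hv' => exact hv'
  | advance hv' => exact absurd hv (P.not_mem_I3_of_mem_I2 hv')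
  | settle hv' => exact absurd hv (P.not_mem_I3_of_mem_I2 hv')
  | wait hv' => exact absurd hv (P.not_mem_I3_of_mem_I2 hv')
  | prepare hv' => exact absurd hv (P.not_mem_I3_of_mem_I2 hv')
  | move hv' => exact absurd hv (P.not_mem_I3_of_mem_I2 hv')

lemma mem_I2 (o : P.Outcome G φ φ' v) (hv : φ' v ∈ P.I2) : φ v ∈ P.I2 := by
  cases o with
  | reduce _ hv' => exact absurd hv' (P.not_mem_I3_of_mem_I2 hv)
  | advance hv' => exact hv'
  | settle hv' => exact hv'
  | wait hv' => exact hv'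
  | prepare hv' => exact hv'
  | move hv' => exact hv'

/-- A settled vertex keeps its first three coordinates as long as it stays in `I₂`. -/
lemma settled (o : P.Outcome G φ φ' v) (hv : φ v ∈ P.I2) (ha : P.a (φ v) < P.lam)
    (hv' : φ' v ∈ P.I2) : P.a (φ' v) = P.a (φ v) ∧ P.b (φ' v) = P.b (φ v) ∧
      P.c (φ' v) = P.c (φ v) := by
  cases o with
  | reduce h => exact absurd h (P.not_mem_I3_of_mem_I2 hv)
  | advance _ h => exact absurd ha (not_lt.2 h)
  | settle _ h => exact absurd ha (not_lt.2 h)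
  | wait _ _ he => rw [he]; exact ⟨rfl, rfl, rfl⟩
  | prepare _ _ _ _ _ ha hb hc => exact ⟨ha, hb, hc⟩
  | move _ _ _ _ _ h => exact absurd h (P.not_mem_I3_of_mem_I2 hv')

lemma a_lt (o : P.Outcome G φ φ' v) (ha : φ v ∈ P.I2 → P.a (φ v) < P.lam) (hv' : φ' v ∈ P.I2) :
    P.a (φ' v) < P.lam := by
  have hv := o.mem_I2 hv'
  rw [(o.settled hv (ha hv) hv').1]
  exact ha hv

lemma core_of_core (o : P.Outcome G φ φ' v) (hv' : φ' v ∈ P.I2) (ha : P.lam ≤ P.a (φ' v)) :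
    φ v ∈ P.I2 ∧ P.lam ≤ P.a (φ v) ∧ rho Δ < (P.M G φ v).card ∧
      P.aHat (φ' v) = P.aHat (φ v) ∧
      P.aTilde (φ' v) = (P.aHat (φ v) + P.aTilde (φ v)) % P.lam ∧
      P.b (φ' v) = P.b (φ v) ∧ P.c (φ' v) = P.c (φ v) ∧ P.d (φ' v) = P.d (φ v) := by
  cases o with
  | advance hv h hM _ h1 h2 h3 h4 h5 => exact ⟨hv, h, hM, h1, h2, h3, h4, h5⟩
  | settle _ _ _ _ h => exact absurd (h ▸ P.aTilde_lt (φ v)) (not_lt.2 ha)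
  | wait _ h he => exact absurd h (not_lt.2 (he ▸ ha))
  | prepare _ h _ _ _ h' => exact absurd (h' ▸ h) (not_lt.2 ha)
  | move _ _ _ _ _ h => exact absurd h (P.not_mem_I3_of_mem_I2 hv')
  | reduce _ h => exact absurd h (P.not_mem_I3_of_mem_I2 hv')

/-- A vertex that ends a round settled has kept its `ã`, and it either was settled before, or has
just settled. -/
lemma settled_cases (o : P.Outcome G φ φ' v) (hv' : φ' v ∈ P.I2) (ha : P.a (φ' v) < P.lam) :
    φ v ∈ P.I2 ∧ P.aTilde (φ v) = P.a (φ' v) ∧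
      ((P.a (φ v) < P.lam ∧ P.a (φ' v) = P.a (φ v) ∧ P.b (φ' v) = P.b (φ v) ∧
        P.c (φ' v) = P.c (φ v)) ∨
      (P.lam ≤ P.a (φ v) ∧ (P.M G φ v).card ≤ rho Δ ∧ P.b (φ' v) ∈ P.Sc (P.scIdx (φ v)) ∧
        (∀ u ∈ P.M' G φ v, P.b (φ' v) ≠ P.b (φ u)) ∧
        (∀ u ∈ P.Mbar' G φ v, P.b (φ' v) ∉ P.Sc (P.scIdx (φ u))) ∧
        P.c (φ' v) = 1 + (P.M' G φ v).sup (fun u => P.c (φ u)) ∧ P.d (φ' v) = P.d (φ v))) := by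
  have hv := o.mem_I2 hv'
  rcases lt_or_ge (P.a (φ v)) P.lam with h | h
  · have hs := o.settled hv h hv'
    exact ⟨hv, by rw [hs.1, P.aTilde_of_lt h], Or.inl ⟨h, hs⟩⟩
  · cases o with
    | advance _ _ _ _ h1 =>
      rw [← P.aHat_eq_zero_iff, h1, P.aHat_eq_zero_iff] at ha
      exact absurd ha (not_lt.2 h)
    | settle _ _ hM _ h1 h2 h3 h4 h5 h6 =>
      exact ⟨hv, h1.symm, Or.inr ⟨h, hM, h2, h3, h4, h5, h6⟩⟩
    | wait _ h' => exact absurd h' (not_lt.2 h)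
    | prepare _ h' => exact absurd h' (not_lt.2 h)
    | move _ h' => exact absurd h' (not_lt.2 h)
    | reduce _ h' => exact absurd h' (P.not_mem_I3_of_mem_I2 hv')

end Outcome

/-! ### The invariant is preserved -/

lemma step_core (h : P.Inv G ψ n φ) (o : ∀ v, P.Outcome G φ φ' v) (hv : φ' v ∈ P.I2)
    (ha : P.lam ≤ P.a (φ' v)) : P.aHat (φ' v) = P.aHat (ψ v) ∧
    P.aTilde (φ' v) = (P.aTilde (ψ v) + (n + 1) * P.aHat (ψ v)) % P.lam ∧
    P.b (φ' v) = P.b (ψ v) ∧ P.d (φ' v) = P.mu := by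
  obtain ⟨hv0, ha0, -, h1, h2, h3, -, h5⟩ := (o v).core_of_core hv ha
  obtain ⟨h1', h2', h3', h4'⟩ := h.core v hv0 ha0
  refine ⟨h1.trans h1', ?_, h3.trans h3', h5.trans h4'⟩
  rw [h2, h1', h2', Nat.add_mod_mod]
  congr 1
  ring

lemma step_b_lt (h : P.Inv G ψ n φ) (o : ∀ v, P.Outcome G φ φ' v) (hv : φ' v ∈ P.I2) :
    P.b (φ' v) < P.tau ^ 2 := by
  have hv0 := (o v).mem_I2 hv
  rcases lt_or_ge (P.a (φ' v)) P.lam with ha | ha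
  · rcases ((o v).settled_cases hv ha).2.2 with h1 | h1
    · rw [h1.2.2.1]; exact h.b_lt v hv0
    · exact P.lt_of_mem_Sc h1.2.2.1
  · rw [((o v).core_of_core hv ha).2.2.2.2.2.1]; exact h.b_lt v hv0

lemma step_c_le (h : P.Inv G ψ n φ) (o : ∀ v, P.Outcome G φ φ' v) (hv : φ' v ∈ P.I2) :
    P.c (φ' v) ≤ n + 1 := by
  have hv0 := (o v).mem_I2 hv
  have hc := h.c_le v hv0
  rcases lt_or_ge (P.a (φ' v)) P.lam with ha | ha
  · rcases ((o v).settled_cases hv ha).2.2 with h1 | h1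
    · rw [h1.2.2.2]; omega
    · rw [h1.2.2.2.2.2.1, add_comm]
      exact Nat.add_le_add_right (Finset.sup_le fun u hu => h.c_le u (mem_M'.1 hu).1.2) 1
  · rw [((o v).core_of_core hv ha).2.2.2.2.2.2.1]; omega

/-- Of two adjacent vertices that settle together, each avoids the member of `F_c` from which the
other one chooses; a vertex that settles next to a settled one avoids its `b` value. -/
lemma step_b_ne (h : P.Inv G ψ n φ) (o : ∀ v, P.Outcome G φ φ' v) (huv : G.Adj u v)
    (hu : φ' u ∈ P.I2) (hv : φ' v ∈ P.I2) (ha : P.a (φ' u) = P.a (φ' v)) :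
    P.b (φ' u) ≠ P.b (φ' v) := by
  rcases lt_or_ge (P.a (φ' v)) P.lam with hlt | hge
  · obtain ⟨hv0, htv, hcv⟩ := (o v).settled_cases hv hlt
    obtain ⟨hu0, htu, hcu⟩ := (o u).settled_cases hu (ha ▸ hlt)
    have ht : P.aTilde (φ u) = P.aTilde (φ v) := by rw [htu, htv, ha]
    rcases hcu with ⟨hul, hua, hub, -⟩ | ⟨hul, -, hub, hub1, hub2, -⟩ <;>
      rcases hcv with ⟨hvl, hva, hvb, -⟩ | ⟨hvl, -, hvb, hvb1, -⟩
    · rw [hub, hvb]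
      exact h.b_ne u v huv hu0 hv0 (by rw [← hua, ← hva, ha])
    · rw [hub]
      exact (hvb1 u (mem_M'.2 ⟨⟨huv.symm, hu0⟩, (P.aHat_eq_zero_iff _).2 hul, ht⟩)).symm
    · rw [hvb]
      exact hub1 v (mem_M'.2 ⟨⟨huv, hv0⟩, (P.aHat_eq_zero_iff _).2 hvl, ht.symm⟩)
    · intro he
      refine hub2 v (mem_Mbar'.2 ⟨⟨huv, hv0⟩, fun h0 => ?_, ht.symm⟩) (he ▸ hvb)
      exact absurd ((P.aHat_eq_zero_iff _).1 h0) (not_lt.2 hvl)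
  · obtain ⟨hv0, hav, -, -, -, hbv, -⟩ := (o v).core_of_core hv hge
    obtain ⟨hu0, hau, -, -, -, hbu, -⟩ := (o u).core_of_core hu (ha ▸ hge)
    obtain ⟨e1, e2, -⟩ := step_core h o hv hge
    obtain ⟨e1', e2', -⟩ := step_core h o hu (ha ▸ hge)
    obtain ⟨f1, f2, -⟩ := h.core v hv0 hav
    obtain ⟨f1', f2', -⟩ := h.core u hu0 hau
    rw [hbu, hbv]
    exact h.b_ne u v huv hu0 hv0 ((a_eq_iff_of_line f1' f2' f1 f2).2
      ((a_eq_iff_of_line e1' e2' e1 e2).1 ha))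

/-- A vertex of `I₃` with a neighbor in `I₂` keeps its color. -/
lemma Outcome.eq_of_adj (o : P.Outcome G φ φ' u) (hu : φ u ∈ P.I3) (huv : G.Adj u v)
    (hv : φ v ∈ P.I2) : φ' u = φ u := by
  cases o with
  | reduce _ _ h =>
    rcases h with h | h
    · exact h
    · exact absurd (h.1 v huv).1 (P.not_mem_I3_of_mem_I2 hv)
  | advance h => exact absurd hu (P.not_mem_I3_of_mem_I2 h)
  | settle h => exact absurd hu (P.not_mem_I3_of_mem_I2 h)
  | wait h => exact absurd hu (P.not_mem_I3_of_mem_I2 h)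
  | prepare h => exact absurd hu (P.not_mem_I3_of_mem_I2 h)
  | move h => exact absurd hu (P.not_mem_I3_of_mem_I2 h)

lemma Outcome.of_move (o : P.Outcome G φ φ' u) (hu : φ u ∈ P.I2) (hu' : φ' u ∈ P.I3) :
    P.a (φ u) < P.lam ∧ P.OutReady G φ u ∧ (∀ w ∈ P.A G φ u, P.d (φ w) ≠ P.mu) ∧
      φ' u ∈ P.L (φ u) (P.d (φ u)) ∧ φ' u ∉ P.occupied G φ u ∧
      ∀ w ∈ P.A G φ u, φ' u ∉ P.L (φ w) (P.d (φ w)) := by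
  cases o with
  | move _ ha h0 _ hA _ hL ho hLA => exact ⟨ha, h0, hA, hL, ho, hLA⟩
  | advance _ _ _ h => exact absurd hu' (P.not_mem_I3_of_mem_I2 h)
  | settle _ _ _ h => exact absurd hu' (P.not_mem_I3_of_mem_I2 h)
  | wait h _ he => exact absurd (he ▸ hu') (P.not_mem_I3_of_mem_I2 h)
  | prepare _ _ _ _ h => exact absurd hu' (P.not_mem_I3_of_mem_I2 h)
  | reduce h => exact absurd h (P.not_mem_I3_of_mem_I2 hu)

/-- Two adjacent vertices that are both ready for transition-out have the same `a` value, so one of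
them lies in the set `A` of the other. -/
lemma mem_A_or_mem_A (huv : G.Adj u v) (hu : φ u ∈ P.I2) (hv : φ v ∈ P.I2)
    (h0u : P.OutReady G φ u) (h0v : P.OutReady G φ v) : u ∈ P.A G φ v ∨ v ∈ P.A G φ u := by
  have h1 := (h0u v (mem_nbrs2.2 ⟨huv, hv⟩)).1
  have h2 := (h0v u (mem_nbrs2.2 ⟨huv.symm, hu⟩)).1
  rcases le_total (P.c (φ u)) (P.c (φ v)) with hc | hc
  · exact Or.inl (mem_A.2 ⟨⟨huv.symm, hu⟩, le_antisymm h1 h2, hc⟩)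
  · exact Or.inr (mem_A.2 ⟨⟨huv, hv⟩, le_antisymm h2 h1, hc⟩)

lemma step_ne_of_mem_I3 (h : P.Inv G ψ n φ) (o : ∀ v, P.Outcome G φ φ' v) (huv : G.Adj u v)
    (hu : φ' u ∈ P.I3) (hv : φ' v ∈ P.I3) : φ' u ≠ φ' v := by
  -- A vertex that moves to `I₃` avoids the colors of its neighbors in `I₃`, which are kept.
  have key : ∀ {u v}, G.Adj u v → φ' v ∈ P.I3 → φ u ∈ P.I3 → φ v ∈ P.I2 → φ' u ≠ φ' v := by
    intro u v huv hv hu0 hv0 he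
    rw [(o u).eq_of_adj hu0 huv hv0] at he
    exact ((o v).of_move hv0 hv).2.2.2.2.1 (mem_occupied.2 ⟨u, ⟨huv.symm, hu0⟩, he⟩)
  rcases h.mem u with hu0 | hu0 <;> rcases h.mem v with hv0 | hv0
  · obtain ⟨-, h0u, -, hLu, -, hAu⟩ := (o u).of_move hu0 hu
    obtain ⟨-, h0v, -, hLv, -, hAv⟩ := (o v).of_move hv0 hv
    intro he
    rcases mem_A_or_mem_A huv hu0 hv0 h0u h0v with hA | hA
    · exact hAv u hA (he ▸ hLu)
    · exact hAu v hA (he ▸ hLv)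
  · exact (key huv.symm hu hv0 hu0).symm
  · exact key huv hv hu0 hv0
  · have hne := h.ne_of_mem_I3 u v huv hu0 hv0
    have hred : ∀ w, φ w ∈ P.I3 → φ' w = φ w ∨ (∀ x, G.Adj w x → φ x ∈ P.I3 ∧ φ x < φ w) ∧
        ∀ x, G.Adj w x → φ' w ≠ φ x := by
      intro w hw
      cases o w with
      | reduce _ _ h => exact h
      | advance h => exact absurd hw (P.not_mem_I3_of_mem_I2 h)
      | settle h => exact absurd hw (P.not_mem_I3_of_mem_I2 h)
      | wait h => exact absurd hw (P.not_mem_I3_of_mem_I2 h)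
      | prepare h => exact absurd hw (P.not_mem_I3_of_mem_I2 h)
      | move h => exact absurd hw (P.not_mem_I3_of_mem_I2 h)
    rcases hred u hu0 with hu1 | ⟨hu1, hu2⟩ <;> rcases hred v hv0 with hv1 | ⟨hv1, hv2⟩
    · rwa [hu1, hv1]
    · rw [hu1]; exact (hv2 u huv.symm).symm
    · rw [hv1]; exact hu2 v huv
    · exact absurd (hu1 v huv).2 (lt_asymm (hv1 u huv.symm).2)

lemma step_card_A (hS : P.Start G ψ) (h : P.Inv G ψ n φ) (o : ∀ v, P.Outcome G φ φ' v)
    (hv : φ' v ∈ P.I2) : (P.A G φ' v).card ≤ 2 * rho Δ := by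
  rcases lt_or_ge (P.a (φ' v)) P.lam with hlt | hge
  · obtain ⟨hv0, htv, ⟨hvl, hva, -, hvc⟩ | ⟨hvl, hM, -⟩⟩ := (o v).settled_cases hv hlt
    · -- A neighbor that joins the class of the settled vertex `v` gets a larger `c` value.
      refine (Finset.card_le_card fun u hu => ?_).trans (h.card_A v hv0)
      rw [mem_A] at hu
      obtain ⟨⟨huv, hu'⟩, hua, huc⟩ := hu
      obtain ⟨hu0, htu, ⟨hul, hua', -, huc'⟩ | ⟨hul, -, -, -, -, hc, -⟩⟩ :=
        (o u).settled_cases hu' (hua ▸ hlt)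
      · exact mem_A.2 ⟨⟨huv, hu0⟩, by rw [← hua', ← hva, hua], by rw [← huc', ← hvc]; exact huc⟩
      · have hmem : v ∈ P.M' G φ u := mem_M'.2 ⟨⟨huv.symm, hv0⟩, (P.aHat_eq_zero_iff _).2 hvl, by
          rw [htv, htu, hua]⟩
        have := Finset.le_sup (f := fun u => P.c (φ u)) hmem
        rw [hc, hvc] at huc
        omega
    · refine (Finset.card_le_card fun u hu => ?_).trans (h.card_same_aTilde_le hS hv0 hvl hM)
      rw [mem_A] at hu
      obtain ⟨hu0, htu, -⟩ := (o u).settled_cases hu.1.2 (hu.2.1 ▸ hlt)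
      exact Finset.mem_filter.2 ⟨mem_nbrs2.2 ⟨hu.1.1, hu0⟩, by rw [htu, htv, hu.2.1]⟩
  · obtain ⟨e1, e2, -⟩ := step_core h o hv hge
    refine ((Finset.card_le_card fun u hu => ?_).trans (hS.defect v)).trans (by omega)
    rw [mem_A] at hu
    obtain ⟨e1', e2', -⟩ := step_core h o hu.1.2 (hu.2.1 ▸ hge)
    exact Finset.mem_filter.2 ⟨(G.mem_neighborFinset v u).2 hu.1.1,
      (a_eq_iff_of_line e1' e2' e1 e2).1 hu.2.1⟩

/-- Each color of a set `S` that is newly taken by a neighbor of `v` is paid for by a neighbor that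
leaves `A(v)`, provided that no other neighbors take colors of `S`. -/
lemma card_inter_occupied_add_card_A_le (h : P.Inv G ψ n φ) (o : ∀ v, P.Outcome G φ φ' v)
    (hv : φ v ∈ P.I2) (ha : P.a (φ v) < P.lam) (hv' : φ' v ∈ P.I2) (h0 : P.OutReady G φ v)
    {S : Finset ℕ} {K : ℕ} (hK : (S ∩ P.occupied G φ v).card + (P.A G φ v).card ≤ K)
    (hnew : ∀ u, G.Adj v u → φ u ∈ P.I2 → φ' u ∈ P.I3 → φ' u ∈ S → u ∈ P.A G φ v) :
    P.OutReady G φ' v ∧ (S ∩ P.occupied G φ' v).card + (P.A G φ' v).card ≤ K := by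
  classical
  have hkeep : ∀ u ∈ P.nbrs2 G φ' v, u ∈ P.nbrs2 G φ v ∧ P.a (φ' u) = P.a (φ u) ∧
      P.c (φ' u) = P.c (φ u) := by
    intro u hu
    rw [mem_nbrs2] at hu
    have hu0 := (o u).mem_I2 hu.2
    have hm : u ∈ P.nbrs2 G φ v := mem_nbrs2.2 ⟨hu.1, hu0⟩
    have hs := (o u).settled hu0 (h0 u hm).2 hu.2
    exact ⟨hm, hs.1, hs.2.2⟩
  obtain ⟨hva, -, hvc⟩ := (o v).settled hv ha hv'
  refine ⟨fun u hu => ?_, ?_⟩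
  · obtain ⟨h1, h2, -⟩ := hkeep u hu
    rw [hva, h2]
    exact h0 u h1
  have h1 : S ∩ P.occupied G φ' v ⊆ (S ∩ P.occupied G φ v) ∪
      ((P.A G φ v).filter (fun u => φ' u ∈ P.I3)).image φ' := by
    intro y hy
    rw [Finset.mem_inter, mem_occupied] at hy
    obtain ⟨hyS, u, ⟨huv, hu'⟩, rfl⟩ := hy
    rw [Finset.mem_union, Finset.mem_inter, mem_occupied]
    rcases h.mem u with hu | hu
    · exact Or.inr (Finset.mem_image_of_mem _
        (Finset.mem_filter.2 ⟨hnew u huv hu hu' hyS, hu'⟩))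
    · exact Or.inl ⟨hyS, u, ⟨huv, hu⟩, ((o u).eq_of_adj hu huv.symm hv).symm⟩
  have h2 : P.A G φ' v ⊆ (P.A G φ v).filter (fun u => ¬ φ' u ∈ P.I3) := by
    intro u hu
    rw [A, Finset.mem_filter] at hu
    obtain ⟨h1, h2, h3⟩ := hkeep u hu.1
    refine Finset.mem_filter.2 ⟨?_, P.not_mem_I3_of_mem_I2 (mem_nbrs2.1 hu.1).2⟩
    rw [mem_A]
    exact ⟨mem_nbrs2.1 h1, by rw [← h2, ← hva, hu.2.1], by rw [← h3, ← hvc]; exact hu.2.2⟩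
  have h3 := (Finset.card_le_card h1).trans ((Finset.card_union_le _ _).trans
    (Nat.add_le_add_left Finset.card_image_le _))
  have h4 := Finset.card_le_card h2
  have h5 := Finset.card_filter_add_card_filter_not (s := P.A G φ v) (fun u => φ' u ∈ P.I3)
  omega

lemma step_ready (h : P.Inv G ψ n φ) (o : ∀ v, P.Outcome G φ φ' v)
    (hv' : φ' v ∈ P.I2) (ha' : P.a (φ' v) < P.lam) (hd' : P.d (φ' v) ≠ P.mu) :
    P.OutReady G φ' v ∧ (P.L (φ' v) (P.d (φ' v)) ∩ P.occupied G φ' v).card +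
      (P.A G φ' v).card ≤ Δ / P.mu + 2 * rho Δ := by
  obtain ⟨hv, -, ⟨ha, -, hb, -⟩ | ⟨ha, -, -, -, -, -, hd⟩⟩ := (o v).settled_cases hv' ha'
  · rw [P.L_congr hb]
    cases o v with
    | wait _ _ he _ =>
      rw [he] at hd' ⊢
      obtain ⟨h0, hK⟩ := h.ready v hv ha hd'
      refine card_inter_occupied_add_card_A_le h o hv ha hv' h0 hK fun u huv hu hu' hL => ?_
      obtain ⟨-, h0u, -, -, -, hAu⟩ := (o u).of_move hu hu'
      rcases mem_A_or_mem_A huv.symm hu hv h0u h0 with hA | hA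
      · exact hA
      · exact absurd hL (hAu v hA)
    | prepare _ _ h0 hd _ _ _ _ _ hmin =>
      refine card_inter_occupied_add_card_A_le h o hv ha hv' h0
        (Nat.add_le_add hmin (h.card_A v hv)) fun u huv hu hu' _ => ?_
      obtain ⟨-, h0u, hAu, -⟩ := (o u).of_move hu hu'
      rcases mem_A_or_mem_A huv.symm hu hv h0u h0 with hA | hA
      · exact hA
      · exact absurd hd (hAu v hA)
    | advance _ h' => exact absurd ha (not_lt.2 h')
    | settle _ h' => exact absurd ha (not_lt.2 h')
    | move _ _ _ _ _ h' => exact absurd h' (P.not_mem_I3_of_mem_I2 hv')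
    | reduce h' => exact absurd h' (P.not_mem_I3_of_mem_I2 hv)
  · exact absurd (hd.trans (h.core v hv ha).2.2.2) hd'

lemma Inv.step (hS : P.Start G ψ) (h : P.Inv G ψ n φ) (o : ∀ v, P.Outcome G φ φ' v) :
    P.Inv G ψ (n + 1) φ' where
  mem v := (o v).mem
  core _ hv ha := step_core h o hv ha
  b_lt _ hv := step_b_lt h o hv
  c_le _ hv := step_c_le h o hv
  b_ne _ _ huv hu hv ha := step_b_ne h o huv hu hv ha
  ne_of_mem_I3 _ _ huv hu hv := step_ne_of_mem_I3 h o huv hu hv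
  card_A _ hv := step_card_A hS h o hv
  ready _ hv ha hd := step_ready h o hv ha hd

/-! ### Termination -/

variable {χ : ℕ → V → ℕ} {T : ℕ}

lemma mem_I3_of_le (o : ∀ n < T, ∀ v, P.Outcome G (χ n) (χ (n + 1)) v) {m n : ℕ} (hmn : m ≤ n)
    (hn : n ≤ T) (hm : χ m v ∈ P.I3) : χ n v ∈ P.I3 := by
  induction n, hmn using Nat.le_induction with
  | base => exact hm
  | succ n hmn ih => exact (o n hn v).mem_I3 (ih (by omega))

lemma settled_of_le (o : ∀ n < T, ∀ v, P.Outcome G (χ n) (χ (n + 1)) v) {m n : ℕ} (hmn : m ≤ n)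
    (hn : n ≤ T) (ha : P.a (χ m v) < P.lam) (hv : χ n v ∈ P.I2) :
    P.a (χ n v) = P.a (χ m v) := by
  induction n, hmn using Nat.le_induction with
  | base => rfl
  | succ n hmn ih =>
    have hv' := (o n hn v).mem_I2 hv
    have h := ih (by omega) hv'
    rw [((o n hn v).settled hv' (h ▸ ha) hv).1, h]

lemma core_of_le (o : ∀ n < T, ∀ v, P.Outcome G (χ n) (χ (n + 1)) v) {m n : ℕ} (hmn : m ≤ n)
    (hn : n ≤ T) (hv : χ n v ∈ P.I2) (ha : P.lam ≤ P.a (χ n v)) :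
    χ m v ∈ P.I2 ∧ P.lam ≤ P.a (χ m v) := by
  induction n, hmn using Nat.le_induction with
  | base => exact ⟨hv, ha⟩
  | succ n hmn ih =>
    obtain ⟨h1, h2, -⟩ := (o n hn v).core_of_core hv ha
    exact ih (by omega) h1 h2

/-- Two lines of different slope over `GF(p)` meet at most once. -/
lemma eq_of_lines_meet {p t t' h h' m n : ℕ} (hp : p.Prime) (hh : h < p) (hh' : h' < p)
    (hne : h ≠ h') (hm : m < p) (hn : n < p) (e1 : (t + m * h) % p = (t' + m * h') % p)
    (e2 : (t + n * h) % p = (t' + n * h') % p) : m = n := by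
  have : Fact p.Prime := ⟨hp⟩
  rw [← ZMod.natCast_eq_natCast_iff'] at e1 e2
  push_cast at e1 e2
  have e3 : ((m : ZMod p) - n) * ((h : ZMod p) - h') = 0 := by linear_combination e1 - e2
  rcases mul_eq_zero.1 e3 with e | e
  · rw [sub_eq_zero, ZMod.natCast_eq_natCast_iff', Nat.mod_eq_of_lt hm, Nat.mod_eq_of_lt hn] at e
    exact e
  · rw [sub_eq_zero, ZMod.natCast_eq_natCast_iff', Nat.mod_eq_of_lt hh, Nat.mod_eq_of_lt hh'] at e
    exact absurd e hne

/-- A neighbor of a core vertex is in conflict with it at most twice during `λ` rounds: once as a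
core vertex and once, with slope `0`, as a settled vertex. -/
lemma card_conflicts_le_two [DecidableEq V] (hS : P.Start G (χ 0))
    (hI : ∀ n ≤ P.lam, P.Inv G (χ 0) n (χ n))
    (o : ∀ n < P.lam, ∀ v, P.Outcome G (χ n) (χ (n + 1)) v)
    (hv : ∀ n ≤ P.lam, χ n v ∈ P.I2 ∧ P.lam ≤ P.a (χ n v)) :
    ((Finset.range P.lam).filter (fun n => u ∈ P.M G (χ n) v)).card ≤ 2 := by
  have hvn : ∀ n < P.lam, P.aHat (χ n v) = P.aHat (χ 0 v) ∧
      P.aTilde (χ n v) = (P.aTilde (χ 0 v) + n * P.aHat (χ 0 v)) % P.lam := fun n hn =>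
    ⟨((hI n hn.le).core v (hv n hn.le).1 (hv n hn.le).2).1,
      ((hI n hn.le).core v (hv n hn.le).1 (hv n hn.le).2).2.1⟩
  rw [← Finset.card_filter_add_card_filter_not (fun n => P.lam ≤ P.a (χ n u))]
  refine Nat.add_le_add (b := 1) (d := 1) (Finset.card_le_one.2 ?_) (Finset.card_le_one.2 ?_)
  · intro m hm n hn
    simp only [Finset.mem_filter, Finset.mem_range, mem_M] at hm hn
    obtain ⟨⟨hm, ⟨-, hmu⟩, hm1, hm2⟩, hm3⟩ := hm
    obtain ⟨⟨hn, ⟨-, hnu⟩, -, hn2⟩, hn3⟩ := hn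
    obtain ⟨c1, c2, -⟩ := (hI m hm.le).core u hmu hm3
    obtain ⟨-, d2, -⟩ := (hI n hn.le).core u hnu hn3
    rw [c1, (hvn m hm).1] at hm1
    rw [c2, (hvn m hm).2] at hm2
    rw [d2, (hvn n hn).2] at hn2
    exact eq_of_lines_meet P.lam_prime (P.aHat_lt (hS.mem u)) (P.aHat_lt (hS.mem v)) hm1 hm hn
      hm2 hn2
  · have key : ∀ m n, m < P.lam → n < P.lam → m ≤ n → u ∈ P.M G (χ m) v → u ∈ P.M G (χ n) v →
        P.a (χ m u) < P.lam → m = n := by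
      intro m n hm hn hmn hmu hnu hm3
      rw [mem_M] at hmu hnu
      have ha := settled_of_le o hmn hn.le hm3 hnu.1.2
      have hm2 := hmu.2.2
      have hn2 := hnu.2.2
      rw [aTilde, (hvn m hm).2] at hm2
      rw [aTilde, ha, (hvn n hn).2] at hn2
      have hslope : P.aHat (χ 0 v) ≠ 0 := by
        rw [Ne, aHat_eq_zero_iff, not_lt]
        exact (hv 0 (Nat.zero_le _)).2
      exact eq_of_lines_meet P.lam_prime P.lam_prime.pos (P.aHat_lt (hS.mem v)) hslope.symm hm hn
        (by simpa using hm2) (by simpa using hn2)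
    intro m hm n hn
    simp only [Finset.mem_filter, Finset.mem_range, not_le] at hm hn
    rcases le_total m n with hmn | hmn
    · exact key m n hm.1.1 hn.1.1 hmn hm.1.2 hn.1.2 hm.2
    · exact (key n m hn.1.1 hm.1.1 hmn hn.1.2 hm.1.2 hn.2).symm

/-- A vertex in the core stage for `λ` rounds would have more than `λ Δ^{1/4} ≥ 2Δ` conflicts. -/
lemma a_lt_at_lam (hΔ : 1 ≤ Δ) (hN : 2 ≤ N) (hdeg : ∀ v, G.degree v ≤ Δ)
    (hS : P.Start G (χ 0)) (hI : ∀ n ≤ P.lam, P.Inv G (χ 0) n (χ n))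
    (o : ∀ n < P.lam, ∀ v, P.Outcome G (χ n) (χ (n + 1)) v) (hv : χ P.lam v ∈ P.I2) :
    P.a (χ P.lam v) < P.lam := by
  classical
  by_contra! ha
  have hcore : ∀ n ≤ P.lam, χ n v ∈ P.I2 ∧ P.lam ≤ P.a (χ n v) := fun n hn =>
    core_of_le o hn le_rfl hv ha
  have hM : ∀ n < P.lam, rho Δ + 1 ≤ (P.M G (χ n) v).card := fun n hn =>
    ((o n hn v).core_of_core (hcore (n + 1) hn).1 (hcore (n + 1) hn).2).2.2.1
  have h1 : P.lam * (rho Δ + 1) ≤ ∑ n ∈ Finset.range P.lam, (P.M G (χ n) v).card := by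
    simpa using Finset.card_nsmul_le_sum (Finset.range P.lam) _ _
      fun n hn => hM n (Finset.mem_range.1 hn)
  have h2 : ∑ n ∈ Finset.range P.lam, (P.M G (χ n) v).card = ∑ u ∈ G.neighborFinset v,
      ((Finset.range P.lam).filter (fun n => u ∈ P.M G (χ n) v)).card := by
    refine Eq.trans (Finset.sum_congr rfl fun n _ => congrArg Finset.card ?_)
      (Finset.sum_card_bipartiteAbove_eq_sum_card_bipartiteBelow (fun n u => u ∈ P.M G (χ n) v))
    ext u
    rw [Finset.mem_bipartiteAbove, SimpleGraph.mem_neighborFinset]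
    exact ⟨fun h => ⟨(mem_M.1 h).1.1, h⟩, fun h => h.2⟩
  have h3 : ∑ u ∈ G.neighborFinset v,
      ((Finset.range P.lam).filter (fun n => u ∈ P.M G (χ n) v)).card ≤ Δ * 2 := by
    refine (Finset.sum_le_card_nsmul _ _ 2 fun u _ =>
      card_conflicts_le_two hS hI o hcore).trans ?_
    rw [G.card_neighborFinset_eq_degree, smul_eq_mul]
    exact Nat.mul_le_mul_right 2 (hdeg v)
  have := P.two_mul_lt_lam_mul hΔ hN
  omega

/-- The invariant holds throughout an execution of `T` rounds after transition-in, and from round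
`λ` on all vertices in `I₂` are settled. -/
lemma Start.execution (hΔ : 1 ≤ Δ) (hN : 2 ≤ N) (hN' : N ≤ 4 * (Δ + 1) ^ 2)
    (hdeg : ∀ v, G.degree v ≤ Δ) (hS : P.Start G (χ 0))
    (hR : ∀ n < T, P.Round G (χ n) (χ (n + 1))) :
    (∀ n ≤ T, P.Inv G (χ 0) n (χ n)) ∧ (∀ n < T, ∀ v, P.Outcome G (χ n) (χ (n + 1)) v) ∧
      ∀ n ≤ T, P.lam ≤ n → ∀ v, χ n v ∈ P.I2 → P.a (χ n v) < P.lam := by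
  have early : ∀ n ≤ T, n ≤ P.lam → P.Inv G (χ 0) n (χ n) := by
    intro n
    induction n with
    | zero => exact fun _ _ => hS.inv hΔ hN hN'
    | succ n ih =>
      intro hn hl
      have h := ih (by omega) (by omega)
      exact h.step hS (h.outcome hΔ hN hdeg (Or.inl hl) (hR n hn))
  have late : ∀ n, P.lam ≤ n → n ≤ T →
      P.Inv G (χ 0) n (χ n) ∧ ∀ v, χ n v ∈ P.I2 → P.a (χ n v) < P.lam := by
    intro n hl
    induction n, hl using Nat.le_induction with
    | base =>
      intro hT
      have hI : ∀ n ≤ P.lam, P.Inv G (χ 0) n (χ n) := fun n hn => early n (by omega) hn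
      exact ⟨hI _ le_rfl, fun v hv => a_lt_at_lam hΔ hN hdeg hS hI (fun n hn =>
        (hI n hn.le).outcome hΔ hN hdeg (Or.inl hn) (hR n (by omega))) hv⟩
    | succ n hl ih =>
      intro hn
      obtain ⟨h, ha⟩ := ih (by omega)
      have o := h.outcome hΔ hN hdeg (Or.inr ha) (hR n hn)
      exact ⟨h.step hS o, fun v hv => (o v).a_lt (ha v) hv⟩
  refine ⟨fun n hn => ?_, fun n hn => ?_, fun n hn hl => (late n hl hn).2⟩
  · rcases le_total n P.lam with hl | hl
    · exact early n hn hl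
    · exact (late n hl hn).1
  · rcases lt_or_ge n P.lam with hl | hl
    · exact (early n hn.le hl.le).outcome hΔ hN hdeg (Or.inl hl) (hR n hn)
    · obtain ⟨h, ha⟩ := late n hl hn.le
      exact h.outcome hΔ hN hdeg (Or.inr ha) (hR n hn)

/-- Once all vertices of `I₂` are settled at `a` values of at least `k`, those with `a = k` are ready
for transition-out: in one round they fix their polynomials, in the next one they move to `I₃`. -/
lemma lt_a_of_two_rounds {φ φ' φ'' : V → ℕ} {k : ℕ} (o : ∀ v, P.Outcome G φ φ' v)
    (o' : ∀ v, P.Outcome G φ' φ'' v) (hlam : ∀ v, φ v ∈ P.I2 → P.a (φ v) < P.lam)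
    (hk : ∀ v, φ v ∈ P.I2 → k ≤ P.a (φ v)) (hv : φ'' v ∈ P.I2) : k < P.a (φ'' v) := by
  have hlam' : ∀ v, φ' v ∈ P.I2 → P.a (φ' v) < P.lam := fun v hv => (o v).a_lt (hlam v) hv
  have hk' : ∀ v, φ' v ∈ P.I2 → k ≤ P.a (φ' v) := fun v hv => by
    have hv0 := (o v).mem_I2 hv
    rw [((o v).settled hv0 (hlam v hv0) hv).1]
    exact hk v hv0
  have hd : ∀ v, φ' v ∈ P.I2 → P.a (φ' v) = k → P.d (φ' v) ≠ P.mu := by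
    intro v hv ha
    have hv0 := (o v).mem_I2 hv
    rw [((o v).settled hv0 (hlam v hv0) hv).1] at ha
    cases o v with
    | wait _ _ he hn =>
      rcases hn with hn | hn
      · refine absurd (fun u hu => ?_) hn
        rw [mem_nbrs2] at hu
        exact ⟨ha ▸ hk u hu.2, hlam u hu.2⟩
      · rw [he]; exact hn.1
    | prepare _ _ _ _ _ _ _ _ hd => exact hd.ne
    | advance h h' => exact absurd (hlam v h) (not_lt.2 h')
    | settle h h' => exact absurd (hlam v h) (not_lt.2 h')
    | move _ _ _ _ _ h => exact absurd h (P.not_mem_I3_of_mem_I2 hv)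
    | reduce h => exact absurd h (P.not_mem_I3_of_mem_I2 hv0)
  have hv1 := (o' v).mem_I2 hv
  rw [((o' v).settled hv1 (hlam' v hv1) hv).1]
  refine lt_of_le_of_ne (hk' v hv1) fun ha => ?_
  cases o' v with
  | wait _ _ _ hn =>
    rcases hn with hn | ⟨-, u, hu, hdu⟩
    · refine hn fun u hu => ?_
      rw [mem_nbrs2] at hu
      exact ⟨ha ▸ hk' u hu.2, hlam' u hu.2⟩
    · rw [mem_A] at hu
      exact hd u hu.1.2 (hu.2.1.trans ha.symm) hdu
  | prepare _ _ _ h => exact hd v hv1 ha.symm h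
  | advance h h' => exact absurd (hlam' v h) (not_lt.2 h')
  | settle h h' => exact absurd (hlam' v h) (not_lt.2 h')
  | move _ _ _ _ _ h => exact absurd h (P.not_mem_I3_of_mem_I2 hv)
  | reduce h => exact absurd h (P.not_mem_I3_of_mem_I2 hv1)

lemma mem_I3_of_three_mul_le (hmem : ∀ n ≤ T, ∀ v, χ n v ∈ P.I2 ∨ χ n v ∈ P.I3)
    (o : ∀ n < T, ∀ v, P.Outcome G (χ n) (χ (n + 1)) v)
    (hlam : ∀ n ≤ T, P.lam ≤ n → ∀ v, χ n v ∈ P.I2 → P.a (χ n v) < P.lam)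
    (hT : 3 * P.lam ≤ T) : χ T v ∈ P.I3 := by
  have key : ∀ k, P.lam + 2 * k ≤ T → ∀ v, χ (P.lam + 2 * k) v ∈ P.I2 →
      k ≤ P.a (χ (P.lam + 2 * k) v) := by
    intro k
    induction k with
    | zero => exact fun _ _ _ => Nat.zero_le _
    | succ k ih =>
      intro hk v hv
      exact lt_a_of_two_rounds (o (P.lam + 2 * k) (by omega)) (o (P.lam + 2 * k + 1) (by omega))
        (hlam _ (by omega) (by omega)) (ih (by omega)) hv
  refine mem_I3_of_le o (show P.lam + 2 * P.lam ≤ T by omega) le_rfl ?_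
  refine (hmem _ (by omega) v).resolve_left fun hv => ?_
  exact absurd (hlam _ (by omega) (by omega) v hv) (not_lt.2 (key P.lam (by omega) v hv))

/-- Every vertex is settled in `I₂` at some point, as it can only leave the core stage by
settling. -/
lemma exists_settled (hS : P.Start G (χ 0))
    (o : ∀ n < P.lam, ∀ v, P.Outcome G (χ n) (χ (n + 1)) v)
    (hlam : χ P.lam v ∈ P.I2 → P.a (χ P.lam v) < P.lam) :
    ∃ n ≤ P.lam, χ n v ∈ P.I2 ∧ P.a (χ n v) < P.lam := by
  by_contra! hcon
  have h : ∀ n ≤ P.lam, χ n v ∈ P.I2 := by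
    intro n
    induction n with
    | zero => exact fun _ => hS.mem v
    | succ n ih =>
      intro hn
      have hv := ih (by omega)
      have ha := hcon n (by omega) hv
      cases o n hn v with
      | advance _ _ _ h => exact h
      | settle _ _ _ h => exact h
      | wait _ h => exact absurd h (not_lt.2 ha)
      | prepare _ h => exact absurd h (not_lt.2 ha)
      | move _ h => exact absurd h (not_lt.2 ha)
      | reduce h => exact absurd h (P.not_mem_I3_of_mem_I2 hv)
  exact absurd (hlam (h _ le_rfl)) (not_lt.2 (hcon _ le_rfl (h _ le_rfl)))

lemma exists_round_of_mem_I1 {φ : V → ℕ} (hN : 2 ≤ N) (hdeg : ∀ v, G.degree v ≤ Δ)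
    (hφ : Proper G φ) (hmem : ∀ v, φ v ∈ P.I1) : ∃ φ', P.Round G φ φ' := by
  choose φ' hφ' using fun v => exists_transitionIn hN (hdeg v) hφ hmem
  exact ⟨φ', fun v => ⟨fun _ => hφ' v,
    fun h => absurd (hmem v) (P.not_mem_I1_of_mem_I2 h),
    fun h => absurd (hmem v) (P.not_mem_I1_of_mem_I2 h),
    fun h => absurd (hmem v) (P.not_mem_I1_of_mem_I3 h)⟩⟩

end Params

end LocIter

open LocIter Params in
theorem mainTheorem2 :
    ∃ C : ℝ, 0 < C ∧
    ∀ Δ N : ℕ, 1 ≤ Δ → 2 ≤ N → N ≤ 4 * (Δ + 1) ^ 2 →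
      Nonempty (LocIter.Params Δ N) ∧
      ∀ P : LocIter.Params Δ N,
        (2 ≤ Δ →
          (P.lam : ℝ) ≤ C * ((Δ : ℝ) ^ (3 / 4 : ℝ) * Real.logb 2 Δ) ∧
          (P.I3.card : ℝ) ≤ Δ + C * ((Δ : ℝ) ^ (3 / 4 : ℝ) * Real.logb 2 Δ)) ∧
        ∀ (V : Type*) [Fintype V] (G : SimpleGraph V) [DecidableRel G.Adj],
          (∀ v, G.degree v ≤ Δ) →
          ∀ (r : ℕ) (φ₀ : V → ℕ), LocIter.Proper G φ₀ → (∀ v, φ₀ v ∈ P.I1) →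
            -- no execution of the algorithm gets stuck
            (∀ (T : ℕ) (φ : ℕ → V → ℕ), r ≤ T → φ r = φ₀ →
              (∀ t, r ≤ t → t < T → P.Round G (φ t) (φ (t + 1))) →
              ∃ φ' : V → ℕ, P.Round G (φ T) φ') ∧
            -- every execution has the asserted properties
            ∀ φ : ℕ → V → ℕ, φ r = φ₀ → (∀ t, r ≤ t → P.Round G (φ t) (φ (t + 1))) →
              (∀ v, φ (r + 2 + 3 * P.lam) v ∈ P.I3) ∧
              (∀ t, r + 1 ≤ t → t ≤ r + 2 + 3 * P.lam → LocIter.Proper G (φ t)) ∧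
              -- the `a` values start as a defective coloring with `λ²` colors ...
              (∀ v, φ (r + 1) v ∈ P.I2 ∧ P.a (φ (r + 1) v) < P.lam ^ 2 ∧
                (((P.nbrs2 G (φ (r + 1)) v).filter
                  (fun u => P.a (φ (r + 1) u) = P.a (φ (r + 1) v))).card : ℝ)
                    ≤ (Δ : ℝ) ^ (1 / 4 : ℝ)) ∧
              -- ... and become an arbdefective coloring with `λ` colors
              (∀ v, ∃ t, r + 1 ≤ t ∧ t ≤ r + 2 + P.lam ∧
                φ t v ∈ P.I2 ∧ P.a (φ t v) < P.lam ∧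
                ∀ t', t ≤ t' → φ t' v ∈ P.I2 → P.a (φ t' v) < P.lam) ∧
              (∀ t, r + 1 ≤ t → ∀ v, φ t v ∈ P.I2 →
                ((P.A G (φ t) v).card : ℝ) ≤ 2 * (Δ : ℝ) ^ (1 / 4 : ℝ)) := by
  refine ⟨500000, by norm_num, fun Δ N hΔ hN hN' => ⟨nonempty_params hΔ hN, fun P => ⟨?_, ?_⟩⟩⟩
  · intro hΔ2
    rw [rpow_three_fourths]
    refine ⟨(P.lam_le_bound hΔ2 hN hN').trans ?_, P.card_I3_le_bound hΔ2 hN hN'⟩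
    have := one_le_logb hΔ2
    gcongr
    norm_num
  intro V _ G _ hdeg r φ₀ hφ₀ hmem
  have hstart : ∀ φ₁, P.Round G φ₀ φ₁ → P.Start G φ₁ := fun φ₁ hR =>
    Start.of_transitionIn hΔ hN hN' hmem fun v => (hR v).1 (hmem v)
  refine ⟨fun T φ hrT hφ hR => ?_, fun φ hφ hR => ?_⟩
  · rcases hrT.eq_or_lt with rfl | hlt
    · rw [hφ]
      exact exists_round_of_mem_I1 hN hdeg hφ₀ hmem
    · obtain ⟨m, rfl⟩ := Nat.exists_eq_add_of_le (Nat.succ_le_of_lt hlt)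
      have hS : P.Start G (φ (r + 1 + 0)) := hstart _ (hφ ▸ hR r le_rfl hlt)
      exact ((Start.execution (χ := fun n => φ (r + 1 + n)) hΔ hN hN' hdeg hS
        fun n hn => hR _ (by omega) (by omega)).1 m le_rfl).exists_round hΔ hN hdeg hS
  · have hS : P.Start G (φ (r + 1 + 0)) := hstart _ (hφ ▸ hR r le_rfl)
    have hexec := fun T => Start.execution (χ := fun n => φ (r + 1 + n)) (T := T) hΔ hN hN' hdeg hS
      fun n _ => hR _ (by omega)
    have hI : ∀ t, r + 1 ≤ t → ∃ n, P.Inv G (φ (r + 1 + 0)) n (φ t) := fun t ht => by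
      obtain ⟨m, rfl⟩ := Nat.exists_eq_add_of_le ht
      exact ⟨m, (hexec m).1 m le_rfl⟩
    have hrho := rho_le Δ
    refine ⟨fun v => ?_, fun t ht _ => ?_, fun v => ⟨hS.mem v, P.a_lt (hS.mem v), ?_⟩,
      fun v => ?_, fun t ht v hv => ?_⟩
    · obtain ⟨h1, h2, h3⟩ := hexec (1 + 3 * P.lam)
      have h := mem_I3_of_three_mul_le (v := v) (fun n hn => (h1 n hn).mem) h2 h3 (by omega)
      rwa [show r + 2 + 3 * P.lam = r + 1 + (1 + 3 * P.lam) by ring]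
    · obtain ⟨n, h⟩ := hI t ht
      exact h.proper
    · refine le_trans ?_ hrho
      refine Nat.cast_le.2 ((Finset.card_le_card fun u hu => ?_).trans (hS.defect v))
      rw [Finset.mem_filter, mem_nbrs2] at hu
      exact Finset.mem_filter.2 ⟨(G.mem_neighborFinset v u).2 hu.1.1, hu.2⟩
    · obtain ⟨-, h2, h3⟩ := hexec P.lam
      obtain ⟨n, hn, hv, ha⟩ := exists_settled (v := v) (χ := fun n => φ (r + 1 + n)) hS h2
        (h3 _ le_rfl le_rfl v)
      refine ⟨r + 1 + n, by omega, by omega, hv, ha, fun t' ht' hv' => ?_⟩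
      obtain ⟨m, rfl⟩ := Nat.exists_eq_add_of_le (show r + 1 ≤ t' by omega)
      have := settled_of_le (hexec m).2.1 (show n ≤ m by omega) le_rfl ha hv'
      exact this ▸ ha
    · obtain ⟨n, h⟩ := hI t ht
      have : ((P.A G (φ t) v).card : ℝ) ≤ 2 * rho Δ := by exact_mod_cast h.card_A v hv
      linarith
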